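/- Let $\alpha_\pm>0$, $\beta_\pm\in(0,1)$, $\lambda_+>1$, $\lambda_->0$. The law $\mathrm{TS}_+(\alpha,\beta,\lambda)$ is the probability law on $[0,\infty)$ with characteristic function $u\mapsto\exp\left(\int_0^\infty (e^{iux}-1)\,\alpha e^{-\lambda x}x^{-1-\beta}\,dx\right)$, and $\mathrm{TS}(\alpha_+,\beta_+,\lambda_+,\alpha_-,\beta_-,\lambda_-)$ is the law of $Y-Z$ with $Y\sim \mathrm{TS}_+(\alpha_+,\beta_+,\lambda_+)$, $Z\sim \mathrm{TS}_+(\alpha_-,\beta_-,\lambda_-)$ independent. Let $(X_t)_{t\ge 0}$ be a TS process on a probability space $(\Omega,\mathcal F,\mathbb P)$, i.e. $X_0=0$ a.s., the increments are independent, and $X_t-X_s\sim \mathrm{TS}(\alpha_+(t-s),\beta_+,\lambda_+,\alpha_-(t-s),\beta_-,\lambda_-)$ for $t>s\geq 0$; let $(\mathcal F_t)$ be its natural filtration. Put $$a_\pm=-\alpha_\pm\Gamma(-\beta_\pm),\quad \underline{\lambda}=\lambda_++\lambda_-,\quad \gamma=a_+\lambda_+^{\beta_+}+a_-\lambda_-^{\beta_-},$$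 $$\zeta=a_+\big((\lambda_+-1)^{\beta_+}-\lambda_+^{\beta_+}\big)+a_-\big((\lambda_-+1)^{\beta_-}-\lambda_-^{\beta_-}\big).$$ Let $S_0,K,T>0$, $r,q\in\mathbb R$, $S_t=S_0e^{(r-q+\zeta)t+X_t}$ and $k=\ln(S_0/K)+(r-q+\zeta)T$. The prices at time $0$ of the cash-or-nothing (CN) and asset-or-nothing (AN) calls with strike $K$ and maturity $T$ are $C_{\mathrm{CN}}=\mathbb E[e^{-rT}\mathbf 1_{\{S_T>K\}}\mid\mathcal F_0]$ and $C_{\mathrm{AN}}=\mathbb E[e^{-rT}S_T\mathbf 1_{\{S_T>K\}}\mid\mathcal F_0]$. For $b>0$ and $s\in\mathbb C^4$, set $$G_b(s)=\frac{\Gamma\left(s_3-\frac{s_1+s_2}2\right)\Gamma\left(1+\frac{s_1+s_2}2+s_3\right)\Gamma\left(\frac{s_1-s_2}2-s_3\right)\Gamma\left(-\frac{s_1}{\beta_+}\right)\Gamma\left(-\frac{s_2}{\beta_-}\right)\Gamma(s_4)}{\Gamma(1+s_1)\Gamma(-s_1)\Gamma(-s_2)\left(\frac{s_1+s_2}{2}+s_3+s_4\right)}\;\underline{\lambda}^{\frac{s_1+s_2}2-s_3}\,b^{-s_4}(a_+T)^{\frac{s_1}{\beta_+}}(a_-T)^{\frac{s_2}{\beta_-}}(-k)^{-\frac{s_1+s_2}2-s_3-s_4}.$$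 Suppose that $k<0$, and let $c\in\mathbb R^4$ be any vector such that, at $s=c$, the arguments of the six gamma functions in the numerator of $G_b$ and the number $\frac{s_1+s_2}2+s_3+s_4$ are all positive. Then both payoffs are integrable, $G_{\lambda_+}$ and $G_{\lambda_+-1}$ are absolutely integrable over $c+i\mathbb R^4$, and, almost surely, $$C_{\mathrm{CN}}=\frac{e^{(\gamma-r)T}}{\beta_+\beta_-}\int_{c+i\mathbb R^4}G_{\lambda_+}(s)\,\frac{ds}{(2\pi i)^4},\qquad C_{\mathrm{AN}}=\frac{Ke^{k+(\gamma-r)T}}{\beta_+\beta_-}\int_{c+i\mathbb R^4}G_{\lambda_+-1}(s)\,\frac{ds}{(2\pi i)^4}.$$ -/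

import Mathlib

open MeasureTheory ProbabilityTheory
open scoped NNReal Matrix

noncomputable section

/-! ### Tempered stable distributions and processes -/

/-- Density of the Lévy measure of the one-sided tempered stable law. -/
def levyDensityTSPlus (α β lam : ℝ) (x : ℝ) : ℝ :=
  (Set.Ioi (0 : ℝ)).indicator (fun x => α * Real.exp (-lam * x) / x ^ (1 + β)) x

/-- `μ` is the law `TS₊(α, β, lam)`: a probability measure supported by `[0, ∞)` with
characteristic function `u ↦ exp (∫ (e^{iux} - 1) ν(x) dx)`. -/
structure IsTSPlus (μ : Measure ℝ) (α β lam : ℝ) : Prop where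
  isProb : IsProbabilityMeasure μ
  support : μ (Set.Iio 0) = 0
  charFun_eq : ∀ u : ℝ, charFun μ u =
    Complex.exp (∫ x : ℝ,
      (Complex.exp (Complex.I * u * x) - 1) * (levyDensityTSPlus α β lam x : ℂ))

/-- `μ` is the double-sided law `TS(αp, βp, lamp, αm, βm, lamm)`: the convolution of a `TS₊` law
and of the reflection of a `TS₊` law. -/
def IsTS (μ : Measure ℝ) (αp βp lamp αm βm lamm : ℝ) : Prop :=
  ∃ μp μm : Measure ℝ, IsTSPlus μp αp βp lamp ∧ IsTSPlus μm αm βm lamm ∧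
    μ = μp.conv (μm.map (fun x => -x))

/-- `X` is a tempered stable process: it starts from `0` and has independent and stationary
increments, the increment over `[s, t]` having the law
`TS(αp (t - s), βp, lamp, αm (t - s), βm, lamm)`. -/
structure IsTSProcess {Ω : Type*} [MeasurableSpace Ω] (P : Measure Ω) (X : ℝ≥0 → Ω → ℝ)
    (αp βp lamp αm βm lamm : ℝ) : Prop where
  zero : ∀ᵐ ω ∂P, X 0 ω = 0
  indep : HasIndepIncrements X P
  law : ∀ s t : ℝ≥0, s < t →
    IsTS (P.map (fun ω => X t ω - X s ω))
      (αp * ((t : ℝ) - s)) βp lamp (αm * ((t : ℝ) - s)) βm lamm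

/-! ### The market model -/

/-- The constant `a = -α Γ(-β)`. -/
def tsA (α β : ℝ) : ℝ := -α * Real.Gamma (-β)

/-- The constant `γ`. -/
def tsGamma (αp βp lamp αm βm lamm : ℝ) : ℝ :=
  tsA αp βp * lamp ^ βp + tsA αm βm * lamm ^ βm

/-- The martingale adjustment `ζ`. -/
def tsZeta (αp βp lamp αm βm lamm : ℝ) : ℝ :=
  tsA αp βp * ((lamp - 1) ^ βp - lamp ^ βp) + tsA αm βm * ((lamm + 1) ^ βm - lamm ^ βm)

/-- The asset price `S_t = S₀ e^{(r - q + ζ) t + X_t}`. -/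
def assetPrice {Ω : Type*} (X : ℝ≥0 → Ω → ℝ) (S₀ r q ζ : ℝ) (t : ℝ≥0) (ω : Ω) : ℝ :=
  S₀ * Real.exp ((r - q + ζ) * t + X t ω)

/-- The log-forward moneyness `k = ln (S₀ / K) + (r - q + ζ) T`. -/
def moneyness (S₀ K r q ζ T : ℝ) : ℝ := Real.log (S₀ / K) + (r - q + ζ) * T

/-- Cash-or-nothing call payoff. -/
def payoffCN (K : ℝ) (S : ℝ) : ℝ := (Set.Ioi K).indicator (fun _ => 1) S

/-- Asset-or-nothing call payoff. -/
def payoffAN (K : ℝ) (S : ℝ) : ℝ := (Set.Ioi K).indicator (fun S => S) S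

/-- The price at time `t` of the claim delivering `payoff S_T` at time `T`: the conditional
expectation of the discounted payoff, given the natural filtration of `X` at time `t`. -/
def claimPrice {Ω : Type*} [MeasurableSpace Ω] (P : Measure Ω) (X : ℝ≥0 → Ω → ℝ)
    (hXm : ∀ t, StronglyMeasurable (X t)) (S₀ r q ζ : ℝ) (payoff : ℝ → ℝ) (T t : ℝ≥0) : Ω → ℝ :=
  P[fun ω => Real.exp (-r * ((T : ℝ) - t)) * payoff (assetPrice X S₀ r q ζ T ω) |
    Filtration.natural X hXm t]

/-! ### Mellin–Barnes integrals -/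

/-- The point `c + i y` of `c + i ℝⁿ`. -/
def contourPoint {n : ℕ} (c y : Fin n → ℝ) : Fin n → ℂ := fun j => c j + Complex.I * y j

/-- Absolute convergence of the integral of `F` over `c + i ℝⁿ`. -/
def MBIntegrable {n : ℕ} (c : Fin n → ℝ) (F : (Fin n → ℂ) → ℂ) : Prop :=
  Integrable (fun y : Fin n → ℝ => F (contourPoint c y))

/-- `∫_{c + i ℝⁿ} F(s) ds / (2 π i)ⁿ`, where `ds = iⁿ dy` on `c + i ℝⁿ`. -/
def mbIntegral {n : ℕ} (c : Fin n → ℝ) (F : (Fin n → ℂ) → ℂ) : ℂ :=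
  (∫ y : Fin n → ℝ, F (contourPoint c y) * Complex.I ^ n) / (2 * Real.pi * Complex.I) ^ n

/-- Quotient of products of gamma functions. -/
def gammaQuot {m p : ℕ} (v : Fin m → ℂ) (w : Fin p → ℂ) : ℂ :=
  (∏ i, Complex.Gamma (v i)) / ∏ i, Complex.Gamma (w i)

/-- The matrix `U`. -/
def matU (βp βm : ℝ) : Matrix (Fin 6) (Fin 4) ℝ :=
  !![-1/2, -1/2, 1, 0;
     1/2, 1/2, 1, 0;
     1/2, -1/2, -1, 0;
     -βp⁻¹, 0, 0, 0;
     0, -βm⁻¹, 0, 0;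
     0, 0, 0, 1]

/-- The vector `u`. -/
def vecU : Fin 6 → ℝ := ![0, 1, 0, 0, 0, 0]

/-- The matrix `D_TS`. -/
def matD : Matrix (Fin 3) (Fin 2) ℝ :=
  !![1, 0;
     -1, 0;
     0, -1]

/-- The vector `d_TS`. -/
def vecD : Fin 3 → ℝ := ![1, 0, 0]

/-- The admissible real parts of the contour. -/
def admissible (βp βm : ℝ) : Set (Fin 4 → ℝ) :=
  {x | (∀ i, 0 < (matU βp βm *ᵥ x + vecU) i) ∧ 0 < x ⬝ᵥ ![1/2, 1/2, 1, 1]}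

/-- The common integrand of the two representations: `b` is the base of the power `b^{-s₄}`,
`lamSum = λ₊ + λ₋`, `Ap = a₊ T`, `Am = a₋ T`, and `k` is the moneyness. -/
def callIntegrand (βp βm lamSum b Ap Am k : ℝ) (s : Fin 4 → ℂ) : ℂ :=
  gammaQuot
      ((matU βp βm).map Complex.ofReal *ᵥ s + fun i => (vecU i : ℂ))
      (matD.map Complex.ofReal *ᵥ ![s 0, s 1] + fun i => (vecD i : ℂ))
    / ((s 0 + s 1) / 2 + s 2 + s 3)
    * (lamSum : ℂ) ^ ((s 0 + s 1) / 2 - s 2)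
    * (b : ℂ) ^ (-s 3)
    * (Ap : ℂ) ^ (s 0 / βp)
    * (Am : ℂ) ^ (s 1 / βm)
    * ((-k : ℝ) : ℂ) ^ (-((s 0 + s 1) / 2) - s 2 - s 3)

end

/-! Put `κ = -k > 0`. Since `S_T > K` means `X_T > κ`, both payoffs are constants times `e^{(λ₊ - b)
X_T} 1_{X_T > κ}`, with `b = λ₊` for CN and `b = λ₊ - 1` for AN. Write `X_T = Y - Z` and tilt the
two laws, `ν± = e^{λ± x} μ±`. Up to a constant factor, `ν±` are untempered stable laws, whose Mellin
transforms are explicit. If `g` is the density of `ν₊`, the substitution `y = x + z` turns the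
expectation into `∫ ν₋(dz) e^{-(λ₊+λ₋) z} ∫_κ^∞ g(x + z) e^{-b x} dx`.

Each factor is then a contour integral: `g(x + z)` is an inverse Mellin integral in `S`; the power
`(x + z)^{-1-S}` occurring there is a Mellin–Barnes integral in `W`; the two exponentials are
Cahen–Mellin integrals in `V` and `R`. After Fubini, the `x`-integral gives `κ^{-(S-W+R)} / (S-W+R)`
and the `z`-integral gives a moment of `ν₋` of order `-(V+W)`. A linear change of variables with
determinant of modulus one gives `G_b`. The core is `mb_representation`, applied in
`truncated_moment_eq_mbIntegral`.

Absolute convergence rests on the coupled `(S, W)` factor. By reflection `1 / (Γ(-S) Γ(1+S))` grows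
at most like `e^{π|Im S|}`, while `Γ(-S/β₊)` and `Γ(W) Γ(1+S-W)` decay at rates arbitrarily close to
`π/(2β₊)` and `π/2` in `|Im S|`. The condition `β₊ < 1` makes the decay win
(`integrable_coupled_gamma`).

The stable facts come from the characteristic function alone. The Lévy exponent is computed, the
Laplace transform is continued to the left half-plane by Phragmén–Lindelöf and then up to the
tempering parameter by a power series with nonnegative terms (`IsTSPlus.integral_exp`), and negative
moments follow by integrating in the Laplace variable (`IsTSPlus.negative_moment`). The density is
obtained by Mellin inversion of the distribution function (`exists_density_of_integrable_mellin`).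
-/

section GammaBounds

/-! ### Euler and Cahen–Mellin integrals; decay of `Γ` on vertical lines. -/

open Complex Set

/-- `t ^ s * exp (-b t)` is integrable on `(0, ∞)`. -/
lemma integrableOn_rpow_mul_exp_neg_mul {s b : ℝ} (hs : -1 < s) (hb : 0 < b) :
    IntegrableOn (fun t : ℝ => t ^ s * Real.exp (-(b * t))) (Ioi 0) := by
  have h := integrableOn_rpow_mul_exp_neg_mul_rpow hs one_pos hb
  simpa only [Real.rpow_one, neg_mul] using h

lemma norm_cpow_mul_cexp {a r : ℂ} {t : ℝ} (ht : 0 < t) :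
    ‖(t : ℂ) ^ a * cexp (-(r * t))‖ = t ^ a.re * Real.exp (-(r.re * t)) := by
  rw [norm_mul, norm_cpow_eq_rpow_re_of_pos ht, norm_exp]
  simp

lemma aestronglyMeasurable_cpow_mul_cexp (a r : ℂ) :
    AEStronglyMeasurable (fun t : ℝ => (t : ℂ) ^ a * cexp (-(r * t)))
      (volume.restrict (Ioi 0)) := by
  refine ContinuousOn.aestronglyMeasurable (fun t ht => ?_) measurableSet_Ioi
  refine ContinuousAt.continuousWithinAt ?_
  refine ContinuousAt.mul ?_ (by fun_prop)
  exact continuousAt_ofReal_cpow_const _ _ (Or.inr (ne_of_gt ht))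

lemma integrableOn_cpow_mul_cexp {a r : ℂ} (ha : -1 < a.re) (hr : 0 < r.re) :
    IntegrableOn (fun t : ℝ => (t : ℂ) ^ a * cexp (-(r * t))) (Ioi 0) := by
  refine (integrableOn_rpow_mul_exp_neg_mul ha hr).mono' (aestronglyMeasurable_cpow_mul_cexp a r) ?_
  filter_upwards [ae_restrict_mem measurableSet_Ioi] with t ht
  exact (norm_cpow_mul_cexp ht).le

/-- Holomorphy in `r` is what lets the identity theorem carry the Euler integral from real `r` to
the half-plane. -/
lemma hasDerivAt_integral_cpow_mul_cexp {a r : ℂ} (ha : 0 < a.re) (hr : 0 < r.re) :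
    HasDerivAt (fun r : ℂ => ∫ t : ℝ in Ioi 0, (t : ℂ) ^ (a - 1) * cexp (-(r * t)))
      (∫ t : ℝ in Ioi 0, -((t : ℂ) ^ a * cexp (-(r * t)))) r := by
  have hpos : 0 < r.re / 2 := by linarith
  refine (hasDerivAt_integral_of_dominated_loc_of_deriv_le
    (F' := fun r t => -((t : ℂ) ^ a * cexp (-(r * t))))
    (bound := fun t : ℝ => t ^ a.re * Real.exp (-(r.re / 2 * t)))
    (Metric.ball_mem_nhds r hpos) ?_ ?_ ?_ ?_ ?_ ?_).2
  · exact Filter.Eventually.of_forall fun x => aestronglyMeasurable_cpow_mul_cexp _ _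
  · exact integrableOn_cpow_mul_cexp (by simpa using ha) hr
  · exact (aestronglyMeasurable_cpow_mul_cexp _ _).neg
  · filter_upwards [ae_restrict_mem measurableSet_Ioi] with t ht x hx
    rw [norm_neg, norm_cpow_mul_cexp ht]
    have hx' : r.re / 2 ≤ x.re := by
      have := (abs_re_le_norm (x - r)).trans (mem_ball_iff_norm.1 hx).le
      rw [sub_re, abs_le] at this
      linarith [this.1]
    have ht0 : (0 : ℝ) < t := ht
    gcongr
  · exact integrableOn_rpow_mul_exp_neg_mul (by linarith) hpos
  · filter_upwards [ae_restrict_mem measurableSet_Ioi] with t ht x hx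
    have ht0 : (t : ℂ) ≠ 0 := ofReal_ne_zero.2 (ne_of_gt ht)
    have h1 : HasDerivAt (fun x : ℂ => cexp (-(x * t))) (cexp (-(x * t)) * -(1 * t)) x :=
      (((hasDerivAt_id x).mul_const (t : ℂ)).neg).cexp
    refine (h1.const_mul ((t : ℂ) ^ (a - 1))).congr_deriv ?_
    rw [cpow_sub _ _ ht0, cpow_one]
    field_simp

/-- The Euler integral along a rotated ray. -/
lemma integral_cpow_mul_cexp_Ioi {a r : ℂ} (ha : 0 < a.re) (hr : 0 < r.re) :
    ∫ t : ℝ in Ioi 0, (t : ℂ) ^ (a - 1) * cexp (-(r * t)) = r ^ (-a) * Gamma a := by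
  have hopen : IsOpen {z : ℂ | 0 < z.re} := isOpen_lt continuous_const continuous_re
  have hconv : IsPreconnected {z : ℂ | 0 < z.re} := (convex_halfSpace_re_gt 0).isPreconnected
  have h1 : AnalyticOnNhd ℂ (fun r : ℂ => ∫ t : ℝ in Ioi 0, (t : ℂ) ^ (a - 1) * cexp (-(r * t)))
      {z : ℂ | 0 < z.re} :=
    DifferentiableOn.analyticOnNhd (fun z hz =>
      (hasDerivAt_integral_cpow_mul_cexp ha hz).differentiableAt.differentiableWithinAt) hopen
  have h2 : AnalyticOnNhd ℂ (fun r : ℂ => r ^ (-a) * Gamma a) {z : ℂ | 0 < z.re} :=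
    DifferentiableOn.analyticOnNhd (fun z hz =>
      ((differentiableAt_id.cpow_const (Or.inl hz)).mul_const _).differentiableWithinAt) hopen
  refine h1.eqOn_of_preconnected_of_frequently_eq h2 hconv (z₀ := 1) (by simp) ?_ hr
  -- The formula is known for positive real `r`; the points `1 + 1/(n+1)` accumulate at `1`, which
  -- suffices for the identity theorem.
  have htend : Filter.Tendsto (fun n : ℕ => ((1 + 1 / ((n : ℝ) + 1) : ℝ) : ℂ)) Filter.atTop
      (nhdsWithin 1 {1}ᶜ) := by
    refine tendsto_nhdsWithin_iff.2 ⟨?_, Filter.Eventually.of_forall fun n => ?_⟩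
    · have := (tendsto_one_div_add_atTop_nhds_zero_nat (𝕜 := ℝ)).const_add 1
      simpa [Function.comp_def] using (continuous_ofReal.tendsto _).comp this
    · have : (0 : ℝ) < 1 / ((n : ℝ) + 1) := by positivity
      simp only [mem_compl_iff, mem_singleton_iff]
      intro h
      have h' := congrArg re h
      rw [ofReal_re, one_re] at h'
      linarith
  refine htend.frequently (Filter.Frequently.of_forall fun n => ?_)
  have hpos : (0 : ℝ) < 1 + 1 / ((n : ℝ) + 1) := by positivity
  rw [integral_cpow_mul_exp_neg_mul_Ioi ha hpos, one_div, cpow_neg, inv_cpow]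
  rw [arg_ofReal_of_nonneg hpos.le]
  exact Real.pi_pos.ne

/-- Exponential decay of `Γ` along vertical lines, at any rate below `π / 2`. -/
lemma exists_norm_Gamma_le {σ θ : ℝ} (hσ : 0 < σ) (hθ0 : 0 ≤ θ) (hθ : θ < Real.pi / 2) :
    ∃ C : ℝ, 0 < C ∧ ∀ y : ℝ, ‖Gamma (σ + y * I)‖ ≤ C * Real.exp (-(θ * |y|)) := by
  have hcos : 0 < Real.cos θ := Real.cos_pos_of_mem_Ioo ⟨by linarith, hθ⟩
  set D := ∫ t : ℝ in Ioi 0, t ^ (σ - 1) * Real.exp (-(Real.cos θ * t)) with hD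
  have hDnn : 0 ≤ D := setIntegral_nonneg measurableSet_Ioi fun t ht => by
    have : (0 : ℝ) < t := ht
    positivity
  -- Rotating the ray by `τ`, i.e. taking `r = e^{iτ}`, bounds the integral by `D` uniformly in `y`,
  -- while `|r^{-s}| = e^{τ y}`. The sign of `τ` is later chosen to match that of `y`.
  have key : ∀ τ : ℝ, |τ| = θ → ∀ y : ℝ, ‖Gamma (σ + y * I)‖ ≤ D * Real.exp (-(τ * y)) := by
    intro τ hτ y
    have hcτ : Real.cos τ = Real.cos θ := by rw [← Real.cos_abs, hτ]
    have hτ' := abs_lt.1 (hτ.trans_lt hθ)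
    have hre : (cexp (τ * I)).re = Real.cos θ := by
      rw [exp_ofReal_mul_I_re, hcτ]
    have hs : 0 < (σ + y * I : ℂ).re := by simpa using hσ
    have h := integral_cpow_mul_cexp_Ioi hs (hre ▸ hcos : 0 < (cexp (τ * I)).re)
    have hle : ‖∫ t : ℝ in Ioi 0, (t : ℂ) ^ ((σ + y * I : ℂ) - 1) * cexp (-(cexp (τ * I) * t))‖
        ≤ D := by
      refine norm_integral_le_of_norm_le (integrableOn_rpow_mul_exp_neg_mul (by linarith) hcos) ?_
      filter_upwards [ae_restrict_mem measurableSet_Ioi] with t ht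
      rw [norm_cpow_mul_cexp ht, hre]
      simp
    have hn : ‖cexp (τ * I) ^ (-(σ + y * I : ℂ))‖ = Real.exp (τ * y) := by
      rw [cpow_def_of_ne_zero (exp_ne_zero _), log_exp (by simp; linarith [Real.pi_pos, hτ'.1])
        (by simp; linarith [Real.pi_pos, hτ'.2]), norm_exp]
      congr 1
      simp
    rw [h, norm_mul, hn] at hle
    rw [Real.exp_neg]
    have he := Real.exp_pos (τ * y)
    rw [← div_eq_mul_inv, le_div_iff₀ he]
    linarith
  refine ⟨D + 1, by linarith, fun y => ?_⟩
  have hb : ‖Gamma (σ + y * I)‖ ≤ D * Real.exp (-(θ * |y|)) := by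
    rcases le_total 0 y with hy | hy
    · rw [abs_of_nonneg hy]; exact key θ (abs_of_nonneg hθ0) y
    · have := key (-θ) (by rw [abs_neg, abs_of_nonneg hθ0]) y
      rw [abs_of_nonpos hy]
      simpa using this
  refine hb.trans ?_
  gcongr
  linarith

lemma continuous_Gamma_vertical {σ : ℝ} (hσ : 0 < σ) :
    Continuous fun y : ℝ => Gamma (σ + y * I) := by
  refine continuous_iff_continuousAt.2 fun y => ?_
  refine ContinuousAt.comp (f := fun y : ℝ => (σ + y * I : ℂ)) (g := Gamma)
    (differentiableAt_Gamma _ fun m h => ?_).continuousAt (by fun_prop)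
  have := congrArg re h
  simp at this
  have hm : (0 : ℝ) ≤ m := Nat.cast_nonneg m
  linarith

lemma integrable_exp_neg_mul_abs {δ : ℝ} (hδ : 0 < δ) :
    Integrable fun y : ℝ => Real.exp (-(δ * |y|)) := by
  have h1 : IntegrableOn (fun y : ℝ => Real.exp (-(δ * |y|))) (Ioi 0) := by
    refine (integrableOn_exp_mul_Ioi (neg_lt_zero.2 hδ) 0).congr_fun (fun y hy => ?_)
      measurableSet_Ioi
    simp only [neg_mul]
    rw [abs_of_pos hy]
  have h2 : IntegrableOn (fun y : ℝ => Real.exp (-(δ * |y|))) (Iic 0) := by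
    refine (integrableOn_exp_mul_Iic hδ 0).congr_fun (fun y hy => ?_) measurableSet_Iic
    simp only []
    rw [abs_of_nonpos hy]; congr 1; ring
  rw [← integrableOn_univ, ← Iic_union_Ioi (a := (0 : ℝ))]
  exact h2.union h1

lemma integrable_Gamma_vertical {σ : ℝ} (hσ : 0 < σ) :
    Integrable fun y : ℝ => Gamma (σ + y * I) := by
  obtain ⟨C, -, hC⟩ := exists_norm_Gamma_le hσ zero_le_one (by linarith [Real.pi_gt_three])
  exact ((integrable_exp_neg_mul_abs one_pos).const_mul C).mono'
    (continuous_Gamma_vertical hσ).aestronglyMeasurable (Filter.Eventually.of_forall hC)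

/-- The Cahen–Mellin integral. -/
lemma integral_Gamma_mul_cpow_neg {σ x : ℝ} (hσ : 0 < σ) (hx : 0 < x) :
    ∫ y : ℝ, Gamma (σ + y * I) * (x : ℂ) ^ (-(σ + y * I : ℂ))
      = 2 * Real.pi * (Real.exp (-x) : ℂ) := by
  have hG : ∀ y : ℝ, mellin (fun x : ℝ => ((Real.exp (-x) : ℝ) : ℂ)) (σ + y * I)
      = Gamma (σ + y * I) := fun y => by
    rw [Gamma_eq_integral (by simpa using hσ), GammaIntegral_eq_mellin]
  have h := mellinInv_mellin_eq σ (fun x : ℝ => ((Real.exp (-x) : ℝ) : ℂ)) hx ?_ ?_ ?_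
  · simp only [mellinInv, hG, smul_eq_mul] at h
    rw [← h]
    simp only [mul_comm (Gamma _)]
    rw [real_smul, ofReal_div, ofReal_mul, ofReal_one, ofReal_ofNat, ← mul_assoc,
      mul_one_div_cancel (by simp [Real.pi_ne_zero]), one_mul]
  · have := GammaIntegral_convergent (s := (σ : ℂ)) (by simpa using hσ)
    refine this.congr_fun (fun t ht => ?_) measurableSet_Ioi
    simp [mul_comm]
  · simpa only [VerticalIntegrable, hG] using integrable_Gamma_vertical hσ
  · fun_prop

end GammaBounds

/-! ### The binomial Mellin–Barnes integral and convergence of the coupled factor. -/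

section MellinBarnes

open Complex Set

/-- The Mellin–Barnes integral of the binomial function. -/
lemma integral_Gamma_mul_Gamma_mul_cpow_neg {σ v : ℝ} {ρ : ℂ} (hσ : 0 < σ) (hρ : σ < ρ.re)
    (hv : 0 < v) :
    ∫ w : ℝ, Gamma (σ + w * I) * Gamma (ρ - (σ + w * I)) * (v : ℂ) ^ (-(σ + w * I : ℂ))
      = 2 * Real.pi * (Gamma ρ * ((1 + v : ℝ) : ℂ) ^ (-ρ)) := by
  -- Insert the Euler integral of `Γ(ρ - s)` in a variable `t`. Integrating in `w` first gives
  -- `e^{-tv}` by Cahen–Mellin, and the remaining `t`-integral is Eulerian with rate `1 + v`.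
  set f : ℝ → ℝ → ℂ := fun t w => ((t : ℂ) ^ (ρ - 1 - (σ + w * I)) * cexp (-(1 * t))) *
    (Gamma (σ + w * I) * (v : ℂ) ^ (-(σ + w * I : ℂ))) with hf
  have hGm : Measurable fun w : ℝ => Gamma (σ + w * I) := (continuous_Gamma_vertical hσ).measurable
  have hmeas : Measurable (Function.uncurry f) := by
    have h1 : Measurable fun p : ℝ × ℝ => Gamma (σ + p.2 * I) := hGm.comp measurable_snd
    simp only [hf, Function.uncurry_def]
    fun_prop
  have hnorm : ∀ t : ℝ, 0 < t → ∀ w : ℝ, ‖f t w‖ =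
      (t ^ (ρ.re - 1 - σ) * Real.exp (-(1 * t))) * (v ^ (-σ) * ‖Gamma (σ + w * I)‖) := by
    intro t ht w
    simp only [hf]
    rw [norm_mul, norm_cpow_mul_cexp ht, norm_mul, norm_cpow_eq_rpow_re_of_pos hv]
    have e1 : (ρ - 1 - (σ + w * I)).re = ρ.re - 1 - σ := by simp
    have e2 : (-(σ + w * I : ℂ)).re = -σ := by simp
    rw [e1, e2, one_re]
    ring
  have hinteg : Integrable (Function.uncurry f) ((volume.restrict (Ioi 0)).prod volume) := by
    have h1 : Integrable (fun t : ℝ => t ^ (ρ.re - 1 - σ) * Real.exp (-(1 * t)))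
        (volume.restrict (Ioi 0)) :=
      integrableOn_rpow_mul_exp_neg_mul (by linarith) one_pos
    have h2 := (integrable_Gamma_vertical hσ).norm.const_mul (v ^ (-σ))
    refine (h1.mul_prod h2).mono' hmeas.aestronglyMeasurable ?_
    have : ∀ᵐ p : ℝ × ℝ ∂((volume.restrict (Ioi 0)).prod volume), p.1 ∈ Ioi (0 : ℝ) :=
      Measure.quasiMeasurePreserving_fst.ae (ae_restrict_mem measurableSet_Ioi)
    filter_upwards [this] with p hp
    exact (hnorm p.1 hp p.2).le
  have hswap := integral_integral_swap hinteg
  have hL : ∫ t in Ioi (0 : ℝ), ∫ w, f t w = 2 * Real.pi * (Gamma ρ * ((1 + v : ℝ) : ℂ) ^ (-ρ)) := by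
    have : ∀ t ∈ Ioi (0 : ℝ), ∫ w, f t w
        = 2 * Real.pi * ((t : ℂ) ^ (ρ - 1) * cexp (-(((1 + v : ℝ) : ℂ) * t))) := by
      intro t ht
      have ht0 : (t : ℂ) ≠ 0 := ofReal_ne_zero.2 (ne_of_gt ht)
      have e1 : ∀ w : ℝ, f t w = ((t : ℂ) ^ (ρ - 1) * cexp (-(1 * t))) *
          (Gamma (σ + w * I) * ((t * v : ℝ) : ℂ) ^ (-(σ + w * I : ℂ))) := by
        intro w
        simp only [hf]
        rw [ofReal_mul, mul_cpow_ofReal_nonneg (le_of_lt ht) hv.le, sub_eq_add_neg,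
          cpow_add _ _ ht0]
        ring
      simp_rw [e1]
      rw [integral_const_mul, integral_Gamma_mul_cpow_neg hσ (mul_pos ht hv), ofReal_exp]
      have e2 : cexp (-(((1 + v : ℝ) : ℂ) * t)) = cexp (-(1 * t)) * cexp ((-(t * v) : ℝ) : ℂ) := by
        rw [← exp_add]; congr 1; push_cast; ring
      rw [e2]
      ring
    rw [setIntegral_congr_fun measurableSet_Ioi this, integral_const_mul,
      integral_cpow_mul_cexp_Ioi (by linarith) (by rw [ofReal_re]; linarith), mul_comm (Gamma ρ)]
  have hR : ∀ w : ℝ, ∫ t in Ioi (0 : ℝ), f t w =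
      Gamma (σ + w * I) * Gamma (ρ - (σ + w * I)) * (v : ℂ) ^ (-(σ + w * I : ℂ)) := by
    intro w
    simp only [hf]
    rw [integral_mul_const]
    have : ∀ t : ℝ, (t : ℂ) ^ (ρ - 1 - (σ + w * I)) = (t : ℂ) ^ (ρ - (σ + w * I) - 1) := fun t => by
      congr 1; ring
    simp_rw [this]
    rw [integral_cpow_mul_cexp_Ioi (by simpa using hρ) (by simp)]
    simp
    ring
  simp_rw [hR] at hswap
  rw [← hswap, hL]

lemma norm_sin_le_exp_abs_im (z : ℂ) : ‖Complex.sin z‖ ≤ Real.exp |z.im| := by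
  have h1 : ‖cexp (-z * I)‖ ≤ Real.exp |z.im| := by
    rw [norm_exp]; gcongr; simpa using le_abs_self z.im
  have h2 : ‖cexp (z * I)‖ ≤ Real.exp |z.im| := by
    rw [norm_exp]; gcongr; simpa using neg_le_abs z.im
  rw [Complex.sin, norm_div, norm_mul, norm_I, mul_one, RCLike.norm_ofNat,
    div_le_iff₀ (by norm_num)]
  exact (norm_sub_le _ _).trans (by linarith)

/-- The reflection formula as an upper bound for `1 / (Γ(-s) Γ(1 + s))`. -/
lemma norm_inv_Gamma_mul_Gamma_le (s : ℂ) :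
    ‖(Gamma (-s) * Gamma (1 + s))⁻¹‖ ≤ Real.exp (Real.pi * |s.im|) := by
  have h := Gamma_mul_Gamma_one_sub (-s)
  rw [sub_neg_eq_add] at h
  rw [h, inv_div, norm_div, norm_real, Real.norm_of_nonneg Real.pi_pos.le]
  have h1 := norm_sin_le_exp_abs_im (Real.pi * -s)
  have h2 : |(Real.pi * -s : ℂ).im| = Real.pi * |s.im| := by
    simp [abs_mul, abs_of_pos Real.pi_pos]
  rw [h2] at h1
  have h3 : (1 : ℝ) ≤ Real.pi := by linarith [Real.pi_gt_three]
  exact (div_le_self (norm_nonneg _) h3).trans h1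

/-- Since `1/β + 1 > 2`, the total decay rate `θ/β + θ` exceeds `π` for `θ` close to `π/2`. The
slack is large enough to give up a fraction `η` of the second term, which is spent on decay in the
other variable. -/
lemma exists_rates {β : ℝ} (hβ : 0 < β) (hβ1 : β < 1) :
    ∃ θ η : ℝ, 0 < θ ∧ θ < Real.pi / 2 ∧ 0 < η ∧ η < 1 ∧ Real.pi < θ / β + (1 - η) * θ := by
  have hr : 1 < β⁻¹ := (one_lt_inv₀ hβ).2 hβ1
  set η := (1 - β) / 2 with hη
  have hη0 : 0 < η := by simp only [hη]; linarith
  have hη1 : η < 1 := by simp only [hη]; linarith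
  have hs : 2 < β⁻¹ + (1 - η) := by
    have : 1 - β < β⁻¹ - 1 := by
      rw [lt_sub_iff_add_lt, ← one_div, lt_div_iff₀ hβ]
      nlinarith
    linarith
  obtain ⟨θ, h1, h2⟩ : ∃ θ, Real.pi / (β⁻¹ + (1 - η)) < θ ∧ θ < Real.pi / 2 :=
    exists_between (by gcongr)
  have hpos : 0 < β⁻¹ + (1 - η) := by linarith
  refine ⟨θ, η, (by positivity : 0 < Real.pi / (β⁻¹ + (1 - η))).trans h1, h2, hη0, hη1, ?_⟩
  rw [div_lt_iff₀ hpos] at h1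
  rw [div_eq_mul_inv]
  linarith

lemma Gamma_neg_div_eq {β c : ℝ} (y : ℝ) :
    Gamma (-(c + y * I : ℂ) / β) = Gamma (((-c / β : ℝ) : ℂ) + ((-y / β : ℝ) : ℂ) * I) := by
  congr 1; push_cast; ring

lemma one_add_sub_eq (c σ y w : ℝ) : (1 + (c + y * I) - (σ + w * I) : ℂ)
    = ((1 + c - σ : ℝ) : ℂ) + ((y - w : ℝ) : ℂ) * I := by push_cast; ring

lemma continuous_inv_Gamma {α : Type*} [TopologicalSpace α] {f : α → ℂ} (hf : Continuous f) :
    Continuous fun x => (Gamma (f x))⁻¹ :=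
  differentiable_one_div_Gamma.continuous.comp hf

/-- Integrability of the coupled factor of the Mellin–Barnes integrand. -/
lemma integrable_coupled_gamma {β c σ : ℝ} (hβ : 0 < β) (hβ1 : β < 1) (hc : c < 0)
    (hσ : 0 < σ) (hσc : σ < 1 + c) :
    Integrable fun p : ℝ × ℝ => Gamma (-(c + p.1 * I : ℂ) / β) *
      (Gamma (-(c + p.1 * I : ℂ)))⁻¹ * (Gamma (1 + (c + p.1 * I : ℂ)))⁻¹ *
      (Gamma (σ + p.2 * I) * Gamma (1 + (c + p.1 * I : ℂ) - (σ + p.2 * I))) := by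
  obtain ⟨θ, η, hθ0, hθ, hη0, hη1, hrate⟩ := exists_rates hβ hβ1
  have hcβ : 0 < -c / β := div_pos (by linarith) hβ
  obtain ⟨C₁, hC₁, h₁⟩ := exists_norm_Gamma_le hcβ hθ0.le hθ
  obtain ⟨C₂, hC₂, h₂⟩ := exists_norm_Gamma_le hσ hθ0.le hθ
  obtain ⟨C₃, hC₃, h₃⟩ := exists_norm_Gamma_le (show 0 < 1 + c - σ by linarith) hθ0.le hθ
  have hδ : 0 < θ / β + (1 - η) * θ - Real.pi := by linarith
  have hb := ((integrable_exp_neg_mul_abs hδ).mul_prod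
    (integrable_exp_neg_mul_abs (mul_pos hη0 hθ0))).const_mul (C₁ * (C₂ * C₃))
  simp_rw [one_add_sub_eq, Gamma_neg_div_eq]
  refine hb.mono' (Continuous.aestronglyMeasurable ?_) (Filter.Eventually.of_forall fun p => ?_)
  · refine ((Continuous.mul ?_ (continuous_inv_Gamma (by fun_prop))).mul
      (continuous_inv_Gamma (by fun_prop))).mul (Continuous.mul ?_ ?_)
    · exact (continuous_Gamma_vertical hcβ).comp (by fun_prop : Continuous fun p : ℝ × ℝ => -p.1 / β)
    · exact (continuous_Gamma_vertical hσ).comp continuous_snd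
    · exact (continuous_Gamma_vertical (show 0 < 1 + c - σ by linarith)).comp
        (by fun_prop : Continuous fun p : ℝ × ℝ => p.1 - p.2)
  · obtain ⟨y, w⟩ := p
    simp only
    rw [mul_assoc (Gamma _), ← mul_inv, norm_mul, norm_mul, norm_mul]
    have e1 := h₁ (-y / β)
    have e2 := h₂ w
    have e3 := h₃ (y - w)
    have e4 := norm_inv_Gamma_mul_Gamma_le (c + y * I)
    have e5 : (c + y * I : ℂ).im = y := by simp
    rw [e5] at e4
    have e6 : |-y / β| = |y| / β := by rw [abs_div, abs_neg, abs_of_pos hβ]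
    rw [e6] at e1
    calc _ ≤ (C₁ * Real.exp (-(θ * (|y| / β))) * Real.exp (Real.pi * |y|)) *
          ((C₂ * Real.exp (-(θ * |w|))) * (C₃ * Real.exp (-(θ * |y - w|)))) := by gcongr
      _ = C₁ * (C₂ * C₃) * Real.exp (-(θ * (|y| / β)) + Real.pi * |y| + (-(θ * |w|) +
          -(θ * |y - w|))) := by
          rw [Real.exp_add, Real.exp_add, Real.exp_add]; ring
      _ ≤ C₁ * (C₂ * C₃) * Real.exp (-((θ / β + (1 - η) * θ - Real.pi) * |y|) +
          -(η * θ * |w|)) := by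
          -- Decay in `|w| + |y - w|` is shared out: a fraction `1 - η` controls `|y|` by the
          -- triangle inequality, the rest keeps `η |w|`.
          have t1 : |y| ≤ |w| + |y - w| := by
            have := abs_add_le w (y - w); rwa [add_sub_cancel] at this
          have t2 : (1 - η) * |y| + η * |w| ≤ |w| + |y - w| := by
            nlinarith [abs_nonneg (y - w)]
          have t3 := mul_le_mul_of_nonneg_left t2 hθ0.le
          have t4 : θ * (|y| / β) = θ / β * |y| := by ring
          refine mul_le_mul_of_nonneg_left (Real.exp_le_exp.2 ?_) (by positivity)
          rw [t4]
          linarith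
      _ = _ := by rw [Real.exp_add]

/-- Integrability along vertical lines of the Mellin transform of a stable density. -/
lemma integrable_Gamma_div_Gamma {β c : ℝ} (hβ : 0 < β) (hβ1 : β < 1) (hc : c < 0)
    (hc1 : -1 < c) :
    Integrable fun y : ℝ => Gamma (-(c + y * I : ℂ) / β) * (Gamma (-(c + y * I : ℂ)))⁻¹ := by
  obtain ⟨θ, η, hθ0, hθ, hη0, hη1, hrate⟩ := exists_rates hβ hβ1
  have hcβ : 0 < -c / β := div_pos (by linarith) hβ
  have hc1' : 0 < 1 + c := by linarith
  obtain ⟨C₁, hC₁, h₁⟩ := exists_norm_Gamma_le hcβ hθ0.le hθ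
  obtain ⟨C₂, hC₂, h₂⟩ := exists_norm_Gamma_le hc1' hθ0.le hθ
  have hδ : 0 < θ / β + (1 - η) * θ - Real.pi := by linarith
  have hb := (integrable_exp_neg_mul_abs hδ).const_mul (C₁ * C₂)
  simp_rw [Gamma_neg_div_eq]
  refine hb.mono' (Continuous.aestronglyMeasurable ?_) (Filter.Eventually.of_forall fun y => ?_)
  · refine (Continuous.mul ?_ (continuous_inv_Gamma (by fun_prop)))
    exact (continuous_Gamma_vertical hcβ).comp (by fun_prop : Continuous fun y : ℝ => -y / β)
  · have hne : Gamma (1 + (c + y * I)) ≠ 0 := Gamma_ne_zero_of_re_pos (by simpa using hc1')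
    -- Multiplying and dividing by `Γ(1 + s)` makes the reflection bound available and gains the
    -- decay of `Γ(1 + s)`; this is where `-1 < c` enters.
    have e0 : (Gamma (-(c + y * I : ℂ)))⁻¹ =
        (Gamma (-(c + y * I : ℂ)) * Gamma (1 + (c + y * I)))⁻¹ * Gamma (1 + (c + y * I)) := by
      rw [mul_inv, mul_assoc, inv_mul_cancel₀ hne, mul_one]
    have e2 := h₂ y
    have e2' : ((1 + c : ℝ) : ℂ) + y * I = 1 + (c + y * I) := by push_cast; ring
    rw [e2'] at e2
    have e1 := h₁ (-y / β)
    have e4 := norm_inv_Gamma_mul_Gamma_le (c + y * I)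
    have e5 : (c + y * I : ℂ).im = y := by simp
    rw [e5] at e4
    have e6 : |-y / β| = |y| / β := by rw [abs_div, abs_neg, abs_of_pos hβ]
    rw [e6] at e1
    rw [e0, norm_mul, norm_mul]
    calc _ ≤ (C₁ * Real.exp (-(θ * (|y| / β)))) *
          (Real.exp (Real.pi * |y|) * (C₂ * Real.exp (-(θ * |y|)))) := by gcongr
      _ = C₁ * C₂ * Real.exp (-(θ * (|y| / β)) + (Real.pi * |y| + -(θ * |y|))) := by
          rw [Real.exp_add, Real.exp_add]; ring
      _ ≤ _ := by
          have t4 : θ * (|y| / β) = θ / β * |y| := by ring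
          gcongr
          rw [t4]
          nlinarith [mul_nonneg (mul_pos hη0 hθ0).le (abs_nonneg y)]

end MellinBarnes

/-! ### The Lévy–Khintchine exponent in closed form. -/

section LevyExponent

open Complex Set

lemma aestronglyMeasurable_levy (α β lam u : ℝ) :
    AEStronglyMeasurable (fun x : ℝ => (cexp (I * u * x) - 1) *
      ((α * Real.exp (-lam * x) / x ^ (1 + β) : ℝ) : ℂ)) (volume.restrict (Ioi 0)) := by
  refine Measurable.aestronglyMeasurable ?_
  fun_prop

/-- Differentiating in `u` brings down a factor `x`, which weakens the singularity `x^{-1-β}` to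
`x^{-β}` and leaves an Euler integral. Domination needs only `∫ x^{-β} e^{-lam x} dx < ∞`. -/
lemma hasDerivAt_levyExponent {α β lam : ℝ} (hβ1 : β < 1) (hlam : 0 < lam) (u : ℝ) :
    HasDerivAt (fun u : ℝ => ∫ x in Ioi (0 : ℝ), (cexp (I * u * x) - 1) *
      ((α * Real.exp (-lam * x) / x ^ (1 + β) : ℝ) : ℂ))
      (I * α * ((lam - I * u : ℂ) ^ (-(1 - β : ℂ)) * Gamma (1 - β))) u := by
  have hbound : ∀ x : ℝ, 0 < x → ∀ C : ℝ, C * x * (|α| * Real.exp (-lam * x) / x ^ (1 + β))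
      = C * |α| * (x ^ (-β) * Real.exp (-(lam * x))) := by
    intro x hx C
    rw [Real.rpow_add hx, Real.rpow_one, Real.rpow_neg hx.le]
    field_simp
  have hnorm : ∀ x : ℝ, 0 < x → ‖((α * Real.exp (-lam * x) / x ^ (1 + β) : ℝ) : ℂ)‖
      = |α| * Real.exp (-lam * x) / x ^ (1 + β) := by
    intro x hx
    rw [norm_real, Real.norm_eq_abs, abs_div, abs_mul, abs_of_pos (Real.exp_pos _),
      abs_of_pos (Real.rpow_pos_of_pos hx _)]
  have hi := (integrableOn_rpow_mul_exp_neg_mul (s := -β) (by linarith) hlam)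
  have key := (hasDerivAt_integral_of_dominated_loc_of_deriv_le (x₀ := u)
    (μ := volume.restrict (Ioi (0 : ℝ)))
    (F := fun (u : ℝ) (x : ℝ) => (cexp (I * u * x) - 1) *
      ((α * Real.exp (-lam * x) / x ^ (1 + β) : ℝ) : ℂ))
    (F' := fun u x => (I * x * cexp (I * u * x)) *
      ((α * Real.exp (-lam * x) / x ^ (1 + β) : ℝ) : ℂ))
    (bound := fun x : ℝ => 1 * |α| * (x ^ (-β) * Real.exp (-(lam * x))))
    Filter.univ_mem ?_ ?_ ?_ ?_ ?_ ?_).2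
  · refine key.congr_deriv ?_
    have hre : 0 < (lam - I * u : ℂ).re := by simpa using hlam
    have h := integral_cpow_mul_cexp_Ioi (a := (1 - β : ℂ)) (by simpa using hβ1) hre
    rw [← h, ← integral_const_mul]
    refine setIntegral_congr_fun measurableSet_Ioi fun x hx => ?_
    have hx0 : (0 : ℝ) < x := hx
    have e1 : (x : ℂ) ^ (1 - β - 1 : ℂ) = ((x ^ (-β) : ℝ) : ℂ) := by
      rw [ofReal_cpow hx0.le]; congr 1; push_cast; ring
    have e2 : cexp (-((lam - I * u) * x)) = cexp (I * u * x) * ((Real.exp (-lam * x) : ℝ) : ℂ) := by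
      rw [ofReal_exp, ← exp_add]; congr 1; push_cast; ring
    have e3 : x ^ (1 + β) = x * (x ^ (-β))⁻¹ := by
      rw [Real.rpow_add hx0, Real.rpow_one, Real.rpow_neg hx0.le, inv_inv]
    have hne : ((x ^ (-β) : ℝ) : ℂ) ≠ 0 := ofReal_ne_zero.2 (Real.rpow_pos_of_pos hx0 _).ne'
    have hxne : (x : ℂ) ≠ 0 := ofReal_ne_zero.2 hx0.ne'
    rw [e1, e2, e3]
    push_cast at hne ⊢
    field_simp
  · exact Filter.Eventually.of_forall fun u => aestronglyMeasurable_levy α β lam u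
  · refine (hi.const_mul (|u| * |α|)).mono' (aestronglyMeasurable_levy α β lam u) ?_
    filter_upwards [ae_restrict_mem measurableSet_Ioi] with x hx
    have hx0 : (0 : ℝ) < x := hx
    rw [norm_mul, hnorm x hx0, ← hbound x hx0]
    gcongr
    have := Real.norm_exp_I_mul_ofReal_sub_one_le (x := u * x)
    rw [Real.norm_eq_abs, abs_mul, abs_of_pos hx0] at this
    rwa [show (I * ((u * x : ℝ) : ℂ)) = I * u * x by push_cast; ring] at this
  · refine Measurable.aestronglyMeasurable ?_
    fun_prop
  · filter_upwards [ae_restrict_mem measurableSet_Ioi] with x hx u _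
    have hx0 : (0 : ℝ) < x := hx
    rw [norm_mul, hnorm x hx0, ← hbound x hx0]
    gcongr
    rw [norm_mul, norm_mul, norm_I, norm_real, Real.norm_of_nonneg hx0.le, norm_exp]
    simp
  · exact hi.const_mul _
  · filter_upwards with x u _
    have h1 : HasDerivAt (fun u : ℝ => cexp (I * u * x)) (cexp (I * u * x) * (I * 1 * x)) u :=
      (((hasDerivAt_id u).ofReal_comp.const_mul I).mul_const (x : ℂ)).cexp
    refine ((h1.sub_const 1).mul_const _).congr_deriv ?_
    ring

/-- The Lévy–Khintchine exponent of the one-sided tempered stable law. -/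
lemma integral_levyDensityTSPlus {α β lam : ℝ} (hβ : 0 < β) (hβ1 : β < 1) (hlam : 0 < lam)
    (u : ℝ) :
    ∫ x : ℝ, (cexp (I * u * x) - 1) * (levyDensityTSPlus α β lam x : ℂ)
      = α * Gamma (-β) * ((lam - I * u : ℂ) ^ (β : ℂ) - (lam : ℂ) ^ (β : ℂ)) := by
  have h0 : ∀ u : ℝ, ∫ x : ℝ, (cexp (I * u * x) - 1) * (levyDensityTSPlus α β lam x : ℂ)
      = ∫ x in Ioi (0 : ℝ), (cexp (I * u * x) - 1) *
        ((α * Real.exp (-lam * x) / x ^ (1 + β) : ℝ) : ℂ) := by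
    intro u
    rw [← integral_indicator measurableSet_Ioi]
    congr 1
    ext x
    by_cases hx : x ∈ Ioi (0 : ℝ)
    · simp [levyDensityTSPlus, hx]
    · simp [levyDensityTSPlus, hx]
  rw [h0]
  have hre : ∀ u : ℝ, 0 < (lam - I * u : ℂ).re := fun u => by simpa using hlam
  have hR : ∀ u : ℝ, HasDerivAt (fun u : ℝ => (α * Gamma (-β) *
      ((lam - I * u : ℂ) ^ (β : ℂ) - (lam : ℂ) ^ (β : ℂ)) : ℂ))
      (I * α * ((lam - I * u : ℂ) ^ (-(1 - β : ℂ)) * Gamma (1 - β))) u := by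
    intro u
    have h1 : HasDerivAt (fun u : ℝ => (lam - I * u : ℂ)) (-(I * 1)) u :=
      ((hasDerivAt_id u).ofReal_comp.const_mul I).const_sub (lam : ℂ)
    have h2 : HasDerivAt (fun z : ℂ => z ^ (β : ℂ)) (β * (lam - I * u : ℂ) ^ (β - 1 : ℂ) * 1)
      (lam - I * u : ℂ) := (hasDerivAt_id _).cpow_const (Or.inl (hre u))
    have h3 := (HasDerivAt.comp u h2 h1).sub_const ((lam : ℂ) ^ (β : ℂ))
    refine (h3.const_mul (α * Gamma (-β) : ℂ)).congr_deriv ?_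
    have hG := Gamma_add_one (-β : ℂ) (by simpa using hβ.ne')
    rw [show (1 - β : ℂ) = -β + 1 by ring, hG]
    rw [show (-(-β + 1) : ℂ) = β - 1 by ring]
    ring
  -- Both sides have the same derivative and vanish at `u = 0`.
  have hd : ∀ v : ℝ, HasDerivAt (fun u : ℝ => (∫ x in Ioi (0 : ℝ), (cexp (I * u * x) - 1) *
        ((α * Real.exp (-lam * x) / x ^ (1 + β) : ℝ) : ℂ)) - (α * Gamma (-β) *
      ((lam - I * u : ℂ) ^ (β : ℂ) - (lam : ℂ) ^ (β : ℂ)) : ℂ)) 0 v := fun v =>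
    ((hasDerivAt_levyExponent hβ1 hlam v).sub (hR v)).congr_deriv (sub_self _)
  have hc := is_const_of_deriv_eq_zero (fun v => (hd v).differentiableAt) (fun v => (hd v).deriv) u 0
  simp only [ofReal_zero, mul_zero, sub_zero, zero_mul, exp_zero, sub_self, integral_zero] at hc
  exact sub_eq_zero.1 hc

end LevyExponent

/-! ### Laplace transform of the one-sided law up to the tempering parameter. -/

section Laplace

open Complex Set Filter Topology

lemma tsA_pos {α β : ℝ} (hα : 0 < α) (hβ : 0 < β) (hβ1 : β < 1) : 0 < tsA α β := by
  have h := Real.Gamma_add_one (s := -β) (by linarith)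
  have h1 : 0 < Real.Gamma (-β + 1) := Real.Gamma_pos_of_pos (by linarith)
  rw [h] at h1
  have h2 : Real.Gamma (-β) < 0 := by nlinarith
  unfold tsA
  nlinarith

/-- A power between `0` and `1` shrinks the argument, so the right half-plane is preserved. This
bounds `tsMGF`, as Phragmén–Lindelöf requires. -/
lemma re_cpow_ofReal_nonneg {w : ℂ} {β : ℝ} (hβ : 0 ≤ β) (hβ1 : β ≤ 1) (hw : 0 ≤ w.re) :
    0 ≤ (w ^ (β : ℂ)).re := by
  rw [cpow_ofReal_re]
  refine mul_nonneg (by positivity) (Real.cos_nonneg_of_mem_Icc ?_)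
  have h : |arg w * β| ≤ Real.pi / 2 := by
    rw [abs_mul, abs_of_nonneg hβ]
    have h1 := abs_arg_le_pi_div_two_iff.2 hw
    have := mul_le_mul h1 hβ1 hβ (by positivity)
    simpa using this
  exact abs_le.1 h

/-- The moment generating function of the one-sided tempered stable law, continued to `re z < lam`. -/
noncomputable def tsMGF (A β lam : ℝ) (z : ℂ) : ℂ :=
  cexp (A * (lam : ℂ) ^ (β : ℂ) - A * (lam - z) ^ (β : ℂ))

lemma differentiableAt_tsMGF {A β lam : ℝ} {z : ℂ} (hz : z.re < lam) :
    DifferentiableAt ℂ (tsMGF A β lam) z := by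
  unfold tsMGF
  refine DifferentiableAt.cexp ?_
  refine (differentiableAt_const _).sub (DifferentiableAt.const_mul ?_ _)
  refine DifferentiableAt.cpow_const (by fun_prop) (Or.inl ?_)
  simpa using hz

lemma norm_tsMGF_le {A β lam : ℝ} (hA : 0 ≤ A) (hβ : 0 ≤ β) (hβ1 : β ≤ 1) {z : ℂ}
    (hz : z.re ≤ lam) : ‖tsMGF A β lam z‖ ≤ Real.exp ((A * (lam : ℂ) ^ (β : ℂ)).re) := by
  rw [tsMGF, norm_exp, Real.exp_le_exp]
  rw [sub_re, re_ofReal_mul A ((lam - z) ^ (β : ℂ))]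
  have := re_cpow_ofReal_nonneg (w := lam - z) hβ hβ1 (by simpa using hz)
  nlinarith

lemma tsMGF_ofReal {A β lam p : ℝ} (hlam : 0 ≤ lam) (hp : 0 ≤ p) :
    tsMGF A β lam ((lam - p : ℝ) : ℂ) = ((Real.exp (A * lam ^ β - A * p ^ β) : ℝ) : ℂ) := by
  rw [tsMGF, ofReal_exp]
  congr 1
  push_cast
  rw [ofReal_cpow hlam, ofReal_cpow hp]
  ring_nf

variable {μ : Measure ℝ} {α β lam : ℝ}

lemma IsTSPlus.ae_nonneg (h : IsTSPlus μ α β lam) : ∀ᵐ x ∂μ, 0 ≤ x := by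
  rw [ae_iff]
  convert h.support using 2
  ext x
  simp

lemma IsTSPlus.Iic_subset (h : IsTSPlus μ α β lam) : Iic 0 ⊆ integrableExpSet id μ := by
  intro t ht
  have := h.isProb
  refine (integrable_const (1 : ℝ)).mono' (by fun_prop) ?_
  filter_upwards [h.ae_nonneg] with x hx
  rw [Real.norm_of_nonneg (Real.exp_pos _).le]
  exact Real.exp_le_one_iff.2 (mul_nonpos_of_nonpos_of_nonneg ht hx)

lemma IsTSPlus.mem_interior (h : IsTSPlus μ α β lam) {t : ℝ} (ht : t < 0) :
    t ∈ interior (integrableExpSet id μ) := by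
  refine interior_mono h.Iic_subset ?_
  rwa [interior_Iic]

lemma IsTSPlus.complexMGF_mul_I (h : IsTSPlus μ α β lam) (hβ : 0 < β) (hβ1 : β < 1)
    (hlam : 0 < lam) (u : ℝ) : complexMGF id μ (u * I) = tsMGF (tsA α β) β lam (u * I) := by
  rw [complexMGF_id_mul_I, h.charFun_eq, integral_levyDensityTSPlus hβ hβ1 hlam, tsMGF]
  congr 1
  rw [tsA, mul_comm I]
  push_cast
  rw [← Gamma_ofReal]
  push_cast
  ring

lemma IsTSPlus.norm_complexMGF_le (h : IsTSPlus μ α β lam) {z : ℂ} (hz : z.re ≤ 0) :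
    ‖complexMGF id μ z‖ ≤ 1 := by
  have := h.isProb
  refine norm_complexMGF_le_mgf.trans ?_
  have : mgf id μ z.re ≤ ∫ _, (1 : ℝ) ∂μ := by
    refine integral_mono_ae (h.Iic_subset hz) (integrable_const _) ?_
    filter_upwards [h.ae_nonneg] with x hx
    exact Real.exp_le_one_iff.2 (mul_nonpos_of_nonpos_of_nonneg hz hx)
  simpa using this

lemma IsTSPlus.continuousOn_complexMGF (h : IsTSPlus μ α β lam) :
    ContinuousOn (complexMGF id μ) {z | z.re ≤ 0} := by
  have := h.isProb
  refine continuousOn_of_dominated (bound := fun _ => 1) (fun z _ => by fun_prop) (fun z hz => ?_)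
    (integrable_const _) (Eventually.of_forall fun x => by fun_prop)
  filter_upwards [h.ae_nonneg] with x hx
  rw [norm_exp]
  refine Real.exp_le_one_iff.2 ?_
  simpa using mul_nonpos_of_nonpos_of_nonneg hz hx

/-- The characteristic function gives equality only on the boundary line `re z = 0`. The difference
is bounded and holomorphic in the half-plane and continuous up to that line, so Phragmén–Lindelöf
forces it to vanish. -/
lemma IsTSPlus.complexMGF_eq_of_re_nonpos (h : IsTSPlus μ α β lam) (hα : 0 < α) (hβ : 0 < β)
    (hβ1 : β < 1) (hlam : 0 < lam) {z : ℂ} (hz : z.re ≤ 0) :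
    complexMGF id μ z = tsMGF (tsA α β) β lam z := by
  set f : ℂ → ℂ := fun z => complexMGF id μ (-z) - tsMGF (tsA α β) β lam (-z) with hf
  have hA := tsA_pos hα hβ hβ1
  set B := 1 + Real.exp ((tsA α β * (lam : ℂ) ^ (β : ℂ)).re) with hB
  have hbound : ∀ z : ℂ, 0 ≤ z.re → ‖f z‖ ≤ B := by
    intro z hz
    refine (norm_sub_le _ _).trans (add_le_add (h.norm_complexMGF_le (by simpa using hz))
      (norm_tsMGF_le hA.le hβ.le hβ1.le ?_))
    rw [neg_re]; linarith
  have hB0 : 0 < B := by positivity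
  have hcl : closure {z : ℂ | 0 < z.re} = {z : ℂ | 0 ≤ z.re} := closure_setOfPred_lt_re 0
  have hdiff : DiffContOnCl ℂ f {z : ℂ | 0 < z.re} := by
    refine ⟨fun z hz => ?_, ?_⟩
    · have hz' : 0 < z.re := hz
      refine DifferentiableAt.differentiableWithinAt (DifferentiableAt.sub ?_ ?_)
      · exact (hasDerivAt_complexMGF (h.mem_interior (by simpa using hz'))).differentiableAt.comp z
          differentiableAt_id.neg
      · exact (differentiableAt_tsMGF (by rw [neg_re]; linarith)).comp z differentiableAt_id.neg
    · rw [hcl]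
      refine ContinuousOn.sub ?_ ?_
      · exact h.continuousOn_complexMGF.comp continuous_neg.continuousOn
          (fun z hz => by simpa using hz)
      · intro z hz
        have hz' : 0 ≤ z.re := hz
        exact ((differentiableAt_tsMGF (by rw [neg_re]; linarith)).continuousAt.comp
          continuous_neg.continuousAt).continuousWithinAt
  -- `C = 0` is the bound on the imaginary axis. Boundedness is the growth condition `O(exp(0 ·
  -- |z|^1))`.
  have key := PhragmenLindelof.right_half_plane_of_bounded_on_real (C := 0) (z := -z) hdiff
    ⟨1, by norm_num, 0, ?_⟩ ?_ ?_ (by simpa using hz)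
  · rw [norm_le_zero_iff] at key
    simp only [hf, neg_neg] at key
    exact sub_eq_zero.1 key
  · refine Asymptotics.IsBigO.of_bound B ?_
    refine Eventually.filter_mono inf_le_right (eventually_principal.2 fun z hz => ?_)
    simpa using hbound z (le_of_lt hz)
  · refine ⟨B, ?_⟩
    rw [eventually_map]
    filter_upwards [eventually_ge_atTop 0] with x hx
    exact hbound x (by simpa using hx)
  · intro x
    rw [norm_le_zero_iff]
    have := h.complexMGF_mul_I hβ hβ1 hlam (-x)
    simp only [hf]
    rw [show -((x : ℂ) * I) = ((-x : ℝ) : ℂ) * I by push_cast; ring, this, sub_self]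

/-- The moment generating function of the one-sided tempered stable law up to the tempering
parameter. -/
lemma IsTSPlus.integral_exp (h : IsTSPlus μ α β lam) (hα : 0 < α) (hβ : 0 < β)
    (hβ1 : β < 1) (hlam : 0 < lam) {p : ℝ} (hp : 0 < p) :
    ∫ x, Real.exp ((lam - p) * x) ∂μ = Real.exp (tsA α β * lam ^ β - tsA α β * p ^ β) := by
  have hpr := h.isProb
  rcases le_or_gt lam p with hlp | hlp
  · have h1 := h.complexMGF_eq_of_re_nonpos hα hβ hβ1 hlam (z := ((lam - p : ℝ) : ℂ))
      (by rw [ofReal_re]; linarith)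
    rw [tsMGF_ofReal hlam.le hp.le, complexMGF_ofReal, ofReal_inj] at h1
    exact h1
  -- For `0 < p < lam` the point lies beyond the half-plane already treated. `tsMGF` is holomorphic
  -- on the disc of centre `-1` and radius `1 + lam`, which contains `z`, and its Taylor
  -- coefficients at `-1` are moments of `e^{-x} μ(dx)`.
  set z : ℂ := ((lam - p : ℝ) : ℂ) with hz
  have hd : DifferentiableOn ℂ (tsMGF (tsA α β) β lam) (Metric.ball (-1) (1 + lam)) := by
    intro w hw
    refine (differentiableAt_tsMGF ?_).differentiableWithinAt
    have := (re_le_norm (w - (-1))).trans_lt (mem_ball_iff_norm.1 hw)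
    simp at this
    linarith
  have hzb : z ∈ Metric.ball (-1 : ℂ) (1 + lam) := by
    rw [mem_ball_iff_norm, hz, sub_neg_eq_add, ← ofReal_one, ← ofReal_add, norm_real,
      Real.norm_of_nonneg (by linarith)]
    linarith
  have hsum := hasSum_taylorSeries_on_ball hd hzb
  have hev : tsMGF (tsA α β) β lam =ᶠ[𝓝 (-1)] complexMGF id μ := by
    have : {w : ℂ | w.re < 0} ∈ 𝓝 (-1 : ℂ) :=
      (isOpen_lt continuous_re continuous_const).mem_nhds (by simp)
    filter_upwards [this] with w hw
    exact (h.complexMGF_eq_of_re_nonpos hα hβ hβ1 hlam (le_of_lt hw)).symm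
  set F : ℕ → ℝ → ℝ := fun n x =>
    (n.factorial : ℝ)⁻¹ * (lam - p + 1) ^ n * (x ^ n * Real.exp (-1 * x)) with hF
  have hinteg : ∀ n, Integrable (F n) μ := fun n => by
    have := integrable_pow_mul_exp_of_mem_interior_integrableExpSet (X := id)
      (h.mem_interior neg_one_lt_zero) n
    exact this.const_mul _
  have hterm : ∀ n : ℕ, ((n.factorial : ℂ)⁻¹ • (z - (-1)) ^ n •
      iteratedDeriv n (tsMGF (tsA α β) β lam) (-1)) = ((∫ x, F n x ∂μ : ℝ) : ℂ) := by
    intro n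
    rw [hev.iteratedDeriv_eq n, iteratedDeriv_complexMGF
      (by simpa using h.mem_interior neg_one_lt_zero) n]
    simp only [hF]
    rw [integral_const_mul, ofReal_mul, ← integral_complex_ofReal]
    simp only [smul_eq_mul, hz, id]
    push_cast
    rw [sub_neg_eq_add, mul_assoc]
  simp_rw [hterm] at hsum
  rw [hz, tsMGF_ofReal hlam.le hp.le, hasSum_ofReal] at hsum
  -- Nonnegativity of the terms turns convergence of the Taylor series into summability of the `L¹`
  -- norms, so sum and integral may be exchanged.
  have hnn : ∀ n, ∀ᵐ x ∂μ, ‖F n x‖ = F n x := fun n => by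
    filter_upwards [h.ae_nonneg] with x hx
    refine Real.norm_of_nonneg ?_
    have : 0 ≤ lam - p + 1 := by linarith
    simp only [hF]
    positivity
  have hsum2 := hasSum_integral_of_summable_integral_norm hinteg (by
    refine hsum.summable.congr fun n => ?_
    exact (integral_congr_ae (hnn n)).symm)
  rw [hsum.unique hsum2]
  refine integral_congr_ae (Eventually.of_forall fun x => ?_)
  have he : HasSum (fun n : ℕ => ((lam - p + 1) * x) ^ n / n.factorial)
      (Real.exp ((lam - p + 1) * x)) := by
    rw [Real.exp_eq_exp_ℝ]
    exact NormedSpace.expSeries_div_hasSum_exp _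
  have he2 := he.mul_right (Real.exp (-1 * x))
  have : Real.exp ((lam - p + 1) * x) * Real.exp (-1 * x) = Real.exp ((lam - p) * x) := by
    rw [← Real.exp_add]; congr 1; ring
  rw [this] at he2
  simp only
  rw [← he2.tsum_eq]
  refine tsum_congr fun n => ?_
  simp only [hF]
  rw [mul_pow]
  ring

end Laplace

/-! ### Exponential tilting and negative moments. -/

section Moments

open Complex Set Filter Topology

/-- The measure `e ^ (lam x) μ(dx)`. -/
noncomputable def expTilt (μ : Measure ℝ) (lam : ℝ) : Measure ℝ :=
  μ.withDensity fun x => ENNReal.ofReal (Real.exp (lam * x))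

lemma expTilt_eq_toNNReal (μ : Measure ℝ) (lam : ℝ) :
    expTilt μ lam = μ.withDensity fun x => ((Real.exp (lam * x)).toNNReal : ENNReal) := rfl

lemma integral_expTilt (μ : Measure ℝ) (lam : ℝ) (f : ℝ → ℂ) :
    ∫ x, f x ∂(expTilt μ lam) = ∫ x, (Real.exp (lam * x) : ℂ) * f x ∂μ := by
  rw [expTilt_eq_toNNReal, integral_withDensity_eq_integral_smul (by fun_prop)]
  refine integral_congr_ae (Eventually.of_forall fun x => ?_)
  simp only [NNReal.smul_def, Real.coe_toNNReal _ (Real.exp_pos _).le, real_smul]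

lemma integrable_expTilt_iff {μ : Measure ℝ} {lam : ℝ} {f : ℝ → ℂ} :
    Integrable f (expTilt μ lam) ↔ Integrable (fun x => (Real.exp (lam * x) : ℂ) * f x) μ := by
  rw [expTilt_eq_toNNReal, integrable_withDensity_iff_integrable_smul (by fun_prop)]
  simp only [NNReal.smul_def, Real.coe_toNNReal _ (Real.exp_pos _).le, real_smul]

instance (μ : Measure ℝ) [SigmaFinite μ] (lam : ℝ) : SigmaFinite (expTilt μ lam) :=
  SigmaFinite.withDensity_of_ne_top (by simp)

variable {μ : Measure ℝ} {α β lam : ℝ}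

/-- A Bochner integral takes the default value `0` on non-integrable functions, so the positive
value already computed proves integrability. -/
lemma IsTSPlus.integrable_exp (h : IsTSPlus μ α β lam) (hα : 0 < α) (hβ : 0 < β)
    (hβ1 : β < 1) (hlam : 0 < lam) {p : ℝ} (hp : 0 < p) :
    Integrable (fun x => Real.exp ((lam - p) * x)) μ :=
  .of_integral_ne_zero (by rw [h.integral_exp hα hβ hβ1 hlam hp]; positivity)

/-- An atom at `0` contributes its full mass to every `∫ e^{(lam - p) x} dμ`, and these tend to `0`
as `p → ∞`. -/
lemma IsTSPlus.ae_pos (h : IsTSPlus μ α β lam) (hα : 0 < α) (hβ : 0 < β)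
    (hβ1 : β < 1) (hlam : 0 < lam) : ∀ᵐ x ∂μ, 0 < x := by
  have hpr := h.isProb
  have hA := tsA_pos hα hβ hβ1
  have hle : ∀ p : ℝ, 0 < p → μ.real {0} ≤ Real.exp (tsA α β * lam ^ β - tsA α β * p ^ β) := by
    intro p hp
    rw [← h.integral_exp hα hβ hβ1 hlam hp, ← integral_indicator_one (measurableSet_singleton 0)]
    refine integral_mono ((integrable_const 1).indicator (measurableSet_singleton 0))
      (h.integrable_exp hα hβ hβ1 hlam hp) fun x => ?_
    by_cases hx : x = 0
    · simp [hx]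
    · simp [hx, Real.exp_nonneg]
  have htend : Tendsto (fun p : ℝ => Real.exp (tsA α β * lam ^ β - tsA α β * p ^ β)) atTop
      (𝓝 0) := by
    refine Real.tendsto_exp_atBot.comp ?_
    refine tendsto_atBot_add_const_left _ _ ?_
    exact tendsto_neg_atTop_atBot.comp ((tendsto_rpow_atTop hβ).const_mul_atTop hA)
  have h0 : μ.real {0} ≤ 0 := ge_of_tendsto htend (by
    filter_upwards [eventually_gt_atTop 0] with p hp using hle p hp)
  have h1 : μ {0} = 0 := by
    rw [← measureReal_eq_zero_iff]
    exact le_antisymm h0 measureReal_nonneg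
  have h2 : ∀ᵐ x ∂μ, x ≠ 0 := by
    rw [ae_iff]; simpa using h1
  filter_upwards [h.ae_nonneg, h2] with x hx hx0
  exact lt_of_le_of_ne hx (Ne.symm hx0)

lemma integral_cpow_mul_exp_neg_rpow {A : ℝ} (hA : 0 < A) (hβ : 0 < β) {w : ℂ} (hw : 0 < w.re) :
    ∫ p : ℝ in Ioi 0, (p : ℂ) ^ (w - 1) * cexp (-(A * ((p ^ β : ℝ) : ℂ)))
      = (A : ℂ) ^ (-(w / β)) * Gamma (w / β) / β := by
  have h := mellin_comp_rpow (fun t : ℝ => cexp (-(A * (t : ℂ)))) w β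
  rw [mellin, mellin] at h
  simp only [smul_eq_mul] at h
  rw [h, integral_cpow_mul_cexp_Ioi, abs_of_pos hβ, real_smul]
  · push_cast
    ring
  · rw [div_ofReal_re]; positivity
  · simpa using hA

/-- The negative moments of the untempered law. -/
lemma IsTSPlus.negative_moment (h : IsTSPlus μ α β lam) (hα : 0 < α) (hβ : 0 < β)
    (hβ1 : β < 1) (hlam : 0 < lam) {w : ℂ} (hw : 0 < w.re) :
    Integrable (fun x : ℝ => (x : ℂ) ^ (-w)) (expTilt μ lam) ∧
    ∫ x : ℝ, (x : ℂ) ^ (-w) ∂(expTilt μ lam) = (Real.exp (tsA α β * lam ^ β) : ℂ) *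
      ((tsA α β : ℂ) ^ (-(w / β)) * Gamma (w / β) / β / Gamma w) := by
  have hpr := h.isProb
  have hA := tsA_pos hα hβ hβ1
  have hΓ : Gamma w ≠ 0 := Gamma_ne_zero_of_re_pos hw
  -- Fubini for this kernel: integrating in `p` gives `Γ(w) x^{-w} e^{lam x}`, while integrating in
  -- `x` gives the Laplace transform `e^{A lam^β} e^{-A p^β}` times `p^{w-1}`, with `A = tsA α β`.
  set f : ℝ → ℝ → ℂ := fun p x => (p : ℂ) ^ (w - 1) * cexp ((lam - p) * x) with hf
  have hmeas : Measurable (Function.uncurry f) := by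
    simp only [hf, Function.uncurry_def]
    fun_prop
  have hexp : ∀ p x : ℝ, cexp ((lam - p) * x) = ((Real.exp ((lam - p) * x) : ℝ) : ℂ) := by
    intro p x; push_cast; rfl
  have hnorm : ∀ p : ℝ, 0 < p → ∀ x, ‖f p x‖ = p ^ (w.re - 1) * Real.exp ((lam - p) * x) := by
    intro p hp x
    simp only [hf]
    rw [norm_mul, norm_cpow_eq_rpow_re_of_pos hp, hexp, norm_real,
      Real.norm_of_nonneg (Real.exp_pos _).le]
    simp
  have hinteg : Integrable (Function.uncurry f) ((volume.restrict (Ioi 0)).prod μ) := by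
    rw [integrable_prod_iff hmeas.aestronglyMeasurable]
    refine ⟨?_, ?_⟩
    · filter_upwards [ae_restrict_mem measurableSet_Ioi] with p hp
      simp only [Function.uncurry, hf, hexp]
      exact ((h.integrable_exp hα hβ hβ1 hlam hp).ofReal (𝕜 := ℂ)).const_mul _
    · have h1 := (integrableOn_rpow_mul_exp_neg_mul_rpow (s := w.re - 1) (by linarith) hβ hA).const_mul
        (Real.exp (tsA α β * lam ^ β))
      refine h1.congr ?_
      filter_upwards [ae_restrict_mem measurableSet_Ioi] with p hp
      simp only [Function.uncurry]
      simp_rw [hnorm p hp]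
      rw [integral_const_mul, h.integral_exp hα hβ hβ1 hlam hp,
        sub_eq_add_neg (tsA α β * lam ^ β), Real.exp_add]
      ring_nf
  have hx : ∀ x : ℝ, 0 < x → ∫ p in Ioi (0 : ℝ), f p x
      = (Real.exp (lam * x) : ℂ) * (x : ℂ) ^ (-w) * Gamma w := by
    intro x hx
    have e : ∀ p : ℝ, f p x = (Real.exp (lam * x) : ℂ) * ((p : ℂ) ^ (w - 1) * cexp (-(x * p))) := by
      intro p
      simp only [hf]
      rw [sub_mul, sub_eq_add_neg ((lam : ℂ) * x), exp_add, mul_comm (p : ℂ) x]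
      push_cast
      ring
    simp_rw [e]
    rw [integral_const_mul, integral_cpow_mul_cexp_Ioi hw (by simpa using hx), mul_assoc]
  have hp : ∀ p ∈ Ioi (0 : ℝ), ∫ x, f p x ∂μ = (Real.exp (tsA α β * lam ^ β) : ℂ) *
      ((p : ℂ) ^ (w - 1) * cexp (-(tsA α β * ((p ^ β : ℝ) : ℂ)))) := by
    intro p hp
    simp only [hf, hexp]
    rw [integral_const_mul, integral_complex_ofReal, h.integral_exp hα hβ hβ1 hlam hp,
      sub_eq_add_neg (tsA α β * lam ^ β), Real.exp_add]
    push_cast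
    ring
  have hxae : ∀ᵐ x ∂μ, ∫ p in Ioi (0 : ℝ), f p x
      = (Real.exp (lam * x) : ℂ) * (x : ℂ) ^ (-w) * Gamma w := by
    filter_upwards [h.ae_pos hα hβ hβ1 hlam] with x hx' using hx x hx'
  refine ⟨?_, ?_⟩
  · rw [integrable_expTilt_iff]
    have := ((hinteg.integral_prod_right).congr hxae).mul_const (Gamma w)⁻¹
    simpa only [mul_assoc, mul_inv_cancel₀ hΓ, mul_one] using this
  · rw [integral_expTilt]
    have hswap := integral_integral_swap hinteg
    rw [integral_congr_ae hxae, setIntegral_congr_fun measurableSet_Ioi hp, integral_const_mul,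
      integral_mul_const, integral_cpow_mul_exp_neg_rpow hA hβ hw] at hswap
    rw [eq_div_of_mul_eq hΓ hswap.symm]
    ring

end Moments

/-! ### Density of a measure by Mellin inversion. -/

section MellinDensity

open Complex Set Filter Topology

variable {ν : Measure ℝ} {c : ℝ}

/-- The Mellin transform of a measure along the line `re s = c`. -/
noncomputable def measureMellin (ν : Measure ℝ) (c t : ℝ) : ℂ :=
  ∫ y : ℝ, (y : ℂ) ^ (c + t * I : ℂ) ∂ν

/-- The density recovered from the Mellin transform of a measure. -/
noncomputable def mellinDensity (ν : Measure ℝ) (c y : ℝ) : ℂ :=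
  1 / (2 * Real.pi) * ∫ t : ℝ, measureMellin ν c t * (y : ℂ) ^ (-(c + t * I : ℂ) - 1)

/-- Integrating the kernel `x^{s-1} 1_{y ≤ x}` in `y` gives `x^{s-1} ν(Iic x)`, and integrating it
in `x` gives `-y^s / s`. Fubini thus yields the Mellin transform of the distribution function; `c <
0` makes the `x`-integral converge at infinity. -/
lemma integrable_tail_kernel [SFinite ν] (hpos : ∀ᵐ y ∂ν, 0 < y) (hc : c < 0)
    (hinteg : Integrable (fun y : ℝ => (y : ℂ) ^ (c : ℂ)) ν) (t : ℝ) :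
    Integrable (fun p : ℝ × ℝ => (p.1 : ℂ) ^ (c + t * I - 1 : ℂ) *
      {q : ℝ × ℝ | q.2 ≤ q.1}.indicator (fun _ => (1 : ℂ)) p)
      ((volume.restrict (Ioi 0)).prod ν) := by
  have hset : MeasurableSet {q : ℝ × ℝ | q.2 ≤ q.1} :=
    measurableSet_le measurable_snd measurable_fst
  have hmeas : Measurable (fun p : ℝ × ℝ => (p.1 : ℂ) ^ (c + t * I - 1 : ℂ) *
      {q : ℝ × ℝ | q.2 ≤ q.1}.indicator (fun _ => (1 : ℂ)) p) := by
    refine Measurable.mul (by fun_prop) (measurable_const.indicator hset)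
  have hnorm : ∀ x : ℝ, 0 < x → ∀ y, ‖(x : ℂ) ^ (c + t * I - 1 : ℂ) *
      {q : ℝ × ℝ | q.2 ≤ q.1}.indicator (fun _ => (1 : ℂ)) (x, y)‖ =
      (Ici y).indicator (fun x => x ^ (c - 1)) x := by
    intro x hx y
    by_cases hxy : y ≤ x
    · simp [indicator, hxy, norm_cpow_eq_rpow_re_of_pos hx]
    · simp [indicator, hxy]
  have hsub : ∀ y : ℝ, 0 < y → Ici y ∩ Ioi 0 = Ici y := fun y hy =>
    inter_eq_left.2 fun x hx => lt_of_lt_of_le hy hx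
  have hio : ∀ y : ℝ, 0 < y → IntegrableOn (fun x : ℝ => x ^ (c - 1)) (Ici y) := fun y hy =>
    (integrableOn_Ici_iff_integrableOn_Ioi).2 (integrableOn_Ioi_rpow_of_lt (by linarith) hy)
  rw [integrable_prod_iff' hmeas.aestronglyMeasurable]
  refine ⟨?_, ?_⟩
  · filter_upwards [hpos] with y hy
    have h1 : Integrable ((Ici y).indicator (fun x => x ^ (c - 1))) (volume.restrict (Ioi 0)) := by
      rw [integrable_indicator_iff measurableSet_Ici, IntegrableOn,
        Measure.restrict_restrict measurableSet_Ici, hsub y hy]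
      exact hio y hy
    refine h1.mono' (hmeas.comp measurable_prodMk_right).aestronglyMeasurable ?_
    filter_upwards [ae_restrict_mem measurableSet_Ioi] with x hx
    exact (hnorm x hx y).le
  · refine (hinteg.norm.mul_const (-c)⁻¹).congr ?_
    filter_upwards [hpos] with y hy
    rw [setIntegral_congr_fun measurableSet_Ioi (fun x hx => hnorm x hx y),
      integral_indicator measurableSet_Ici, Measure.restrict_restrict measurableSet_Ici, hsub y hy,
      integral_Ici_eq_integral_Ioi, integral_Ioi_rpow_of_lt (by linarith) hy,
      norm_cpow_eq_rpow_re_of_pos hy, sub_add_cancel, ofReal_re]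
    have : c ≠ 0 := hc.ne
    field_simp

lemma integral_tail_kernel (y : ℝ) (hy : 0 < y) (hc : c < 0) (t : ℝ) :
    ∫ x in Ioi (0 : ℝ), (x : ℂ) ^ (c + t * I - 1 : ℂ) *
      {q : ℝ × ℝ | q.2 ≤ q.1}.indicator (fun _ => (1 : ℂ)) (x, y)
      = (y : ℂ) ^ (c + t * I : ℂ) * (-(c + t * I : ℂ))⁻¹ := by
  have h : ∀ x : ℝ, (x : ℂ) ^ (c + t * I - 1 : ℂ) *
      {q : ℝ × ℝ | q.2 ≤ q.1}.indicator (fun _ => (1 : ℂ)) (x, y) =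
      (Ici y).indicator (fun x : ℝ => (x : ℂ) ^ (c + t * I - 1 : ℂ)) x := by
    intro x
    by_cases hxy : y ≤ x <;> simp [indicator, hxy]
  have hsub : Ici y ∩ Ioi 0 = Ici y := inter_eq_left.2 fun x hx => lt_of_lt_of_le hy hx
  simp_rw [h]
  rw [integral_indicator measurableSet_Ici, Measure.restrict_restrict measurableSet_Ici, hsub,
    integral_Ici_eq_integral_Ioi, integral_Ioi_cpow_of_lt (by simp; linarith) hy, sub_add_cancel,
    inv_neg, div_eq_mul_inv]
  ring

lemma integral_tail_kernel_right (x t : ℝ) :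
    ∫ y, (x : ℂ) ^ (c + t * I - 1 : ℂ) *
      {q : ℝ × ℝ | q.2 ≤ q.1}.indicator (fun _ => (1 : ℂ)) (x, y) ∂ν
      = (x : ℂ) ^ (c + t * I - 1 : ℂ) • ((ν.real (Iic x) : ℝ) : ℂ) := by
  have h : ∀ y : ℝ, {q : ℝ × ℝ | q.2 ≤ q.1}.indicator (fun _ => (1 : ℂ)) (x, y) =
      (Iic x).indicator (fun _ => (1 : ℂ)) y := by
    intro y
    by_cases hxy : y ≤ x <;> simp [indicator, hxy]
  simp_rw [h]
  rw [integral_const_mul, integral_indicator_const _ measurableSet_Iic]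
  simp

lemma mellin_measure_Iic [SFinite ν] (hpos : ∀ᵐ y ∂ν, 0 < y) (hc : c < 0)
    (hinteg : Integrable (fun y : ℝ => (y : ℂ) ^ (c : ℂ)) ν) (t : ℝ) :
    mellin (fun x : ℝ => ((ν.real (Iic x) : ℝ) : ℂ)) (c + t * I)
      = measureMellin ν c t * (-(c + t * I : ℂ))⁻¹ := by
  have hK := integrable_tail_kernel hpos hc hinteg t
  have h := integral_integral_swap (f := fun (x y : ℝ) => (x : ℂ) ^ (c + t * I - 1 : ℂ) *
      {q : ℝ × ℝ | q.2 ≤ q.1}.indicator (fun _ => (1 : ℂ)) (x, y)) hK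
  rw [mellin]
  simp_rw [← integral_tail_kernel_right]
  rw [h, measureMellin, ← integral_mul_const]
  refine integral_congr_ae ?_
  filter_upwards [hpos] with y hy using integral_tail_kernel y hy hc t

lemma mellinConvergent_measure_Iic [SFinite ν] (hpos : ∀ᵐ y ∂ν, 0 < y) (hc : c < 0)
    (hinteg : Integrable (fun y : ℝ => (y : ℂ) ^ (c : ℂ)) ν) :
    MellinConvergent (fun x : ℝ => ((ν.real (Iic x) : ℝ) : ℂ)) c := by
  have hK := (integrable_tail_kernel hpos hc hinteg 0).integral_prod_left
  simp_rw [integral_tail_kernel_right] at hK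
  simpa [MellinConvergent, IntegrableOn] using hK

/-- Markov's inequality for the decreasing function `y ↦ y^c`; `ν` itself is not assumed finite. -/
lemma measure_Iic_lt_top (hpos : ∀ᵐ y ∂ν, 0 < y) (hc : c < 0)
    (hinteg : Integrable (fun y : ℝ => (y : ℂ) ^ (c : ℂ)) ν) (x : ℝ) : ν (Iic x) < ⊤ := by
  rcases le_or_gt x 0 with hx | hx
  · have : ν (Iic x) = 0 := by
      refine measure_mono_null (fun y hy => ?_) (ae_iff.1 hpos)
      exact not_lt.2 (le_trans hy hx)
    simp [this]
  · have h1 := hinteg.measure_norm_ge_lt_top (Real.rpow_pos_of_pos hx c)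
    refine lt_of_le_of_lt (measure_mono_ae ?_) h1
    filter_upwards [hpos] with y hy hyx
    have hyx' : y ≤ x := hyx
    change x ^ c ≤ ‖(y : ℂ) ^ (c : ℂ)‖
    rw [norm_cpow_eq_rpow_re_of_pos hy, ofReal_re]
    exact Real.rpow_le_rpow_of_nonpos hy hyx' hc.le

lemma rpow_le_add_rpow {a x b e : ℝ} (ha : 0 < a) (hax : a ≤ x) (hxb : x ≤ b) :
    x ^ e ≤ a ^ e + b ^ e := by
  have hx : 0 < x := ha.trans_le hax
  have hb : 0 < b := hx.trans_le hxb
  rcases le_total 0 e with he | he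
  · have := Real.rpow_le_rpow hx.le hxb he
    have := Real.rpow_nonneg ha.le e
    linarith
  · have := Real.rpow_le_rpow_of_nonpos ha hax he
    have := Real.rpow_nonneg hb.le e
    linarith

/-- A primitive of `mellinDensity` as an inverse Mellin integral. -/
lemma hasDerivAt_mellin_primitive (hc : c < 0)
    (hM : Integrable (measureMellin ν c)) {x : ℝ} (hx : 0 < x) :
    HasDerivAt (fun x : ℝ => 1 / (2 * Real.pi : ℂ) * ∫ t : ℝ, (x : ℂ) ^ (-(c + t * I : ℂ)) *
      (measureMellin ν c t * (-(c + t * I : ℂ))⁻¹)) (mellinDensity ν c x) x := by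
  refine HasDerivAt.const_mul _ ?_
  have hs : ∀ t : ℝ, (c + t * I : ℂ) ≠ 0 := fun t h => by
    have := congrArg re h
    simp at this
    exact hc.ne this
  have hnb : Ioo (x / 2) (2 * x) ∈ 𝓝 x := Ioo_mem_nhds (by linarith) (by linarith)
  have hm : ∀ z : ℝ, ∀ e : ℂ, AEStronglyMeasurable (fun t : ℝ => (z : ℂ) ^ (-(c + t * I : ℂ) + e))
      volume := fun z e => Measurable.aestronglyMeasurable (by fun_prop)
  have hm' : AEStronglyMeasurable (fun t : ℝ => (-(c + t * I : ℂ))⁻¹) volume :=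
    Measurable.aestronglyMeasurable (by fun_prop)
  refine (hasDerivAt_integral_of_dominated_loc_of_deriv_le
    (F' := fun (x t : ℝ) => measureMellin ν c t * (x : ℂ) ^ (-(c + t * I : ℂ) - 1))
    (bound := fun t => ‖measureMellin ν c t‖ * ((x / 2) ^ (-c - 1) + (2 * x) ^ (-c - 1)))
    hnb ?_ ?_ ?_ ?_ ?_ ?_).2
  · refine Eventually.of_forall fun z => ?_
    have := hm z 0
    simp only [add_zero] at this
    exact this.mul (hM.aestronglyMeasurable.mul hm')
  · refine (hM.norm.mul_const (x ^ (-c) * (-c)⁻¹)).mono' ?_ (Eventually.of_forall fun t => ?_)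
    · have := hm x 0
      simp only [add_zero] at this
      exact this.mul (hM.aestronglyMeasurable.mul hm')
    · rw [norm_mul, norm_mul, norm_cpow_eq_rpow_re_of_pos hx, norm_inv, norm_neg]
      have h1 : -c ≤ ‖(c + t * I : ℂ)‖ := by
        have := abs_re_le_norm (c + t * I : ℂ)
        simp only [add_re, ofReal_re, mul_re, I_re, mul_zero, ofReal_im, I_im, mul_one, sub_self,
          add_zero] at this
        rwa [abs_of_neg hc] at this
      have h2 : ‖(c + t * I : ℂ)‖⁻¹ ≤ (-c)⁻¹ := inv_anti₀ (by linarith) h1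
      have h3 : (-(c + t * I : ℂ)).re = -c := by simp
      rw [h3]
      calc _ ≤ x ^ (-c) * (‖measureMellin ν c t‖ * (-c)⁻¹) := by gcongr
        _ = _ := by ring
  · exact hM.aestronglyMeasurable.mul (hm x (-1))
  · refine Eventually.of_forall fun t z hz => ?_
    have hz0 : 0 < z := lt_trans (by linarith) hz.1
    have h3 : (-(c + t * I : ℂ) - 1).re = -c - 1 := by simp
    rw [norm_mul, norm_cpow_eq_rpow_re_of_pos hz0, h3]
    gcongr
    exact rpow_le_add_rpow (by linarith) hz.1.le hz.2.le
  · exact hM.norm.mul_const _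
  · refine Eventually.of_forall fun t z hz => ?_
    have hz0 : 0 < z := lt_trans (by linarith) hz.1
    have h1 := hasDerivAt_ofReal_cpow_const (x := z) hz0.ne' (r := -(c + t * I : ℂ))
      (neg_ne_zero.2 (hs t))
    refine (h1.mul_const _).congr_deriv ?_
    have := hs t
    field_simp

/-- In the variable `log y` the integral is the Fourier transform of an integrable function, up to
the factor `y^{-c-1}`. -/
lemma continuousOn_mellinDensity (hM : Integrable (measureMellin ν c)) :
    ContinuousOn (mellinDensity ν c) (Ioi 0) := by
  have h : Continuous fun u : ℝ => ∫ t : ℝ, measureMellin ν c t * cexp (-(t * I * u)) := by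
    refine continuous_of_dominated (bound := fun t => ‖measureMellin ν c t‖) (fun u => ?_)
      (fun u => Eventually.of_forall fun t => ?_) hM.norm
      (Eventually.of_forall fun t => by fun_prop)
    · exact hM.aestronglyMeasurable.mul (Measurable.aestronglyMeasurable (by fun_prop))
    · rw [norm_mul, norm_exp]
      simp
  have e : ∀ y ∈ Ioi (0 : ℝ), mellinDensity ν c y = 1 / (2 * Real.pi) * ((y : ℂ) ^ (-c - 1 : ℂ) *
      ∫ t : ℝ, measureMellin ν c t * cexp (-(t * I * (Real.log y : ℝ)))) := by
    intro y hy
    have hy0 : (y : ℂ) ≠ 0 := ofReal_ne_zero.2 (ne_of_gt hy)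
    rw [mellinDensity, ← integral_const_mul ((y : ℂ) ^ (-c - 1 : ℂ))]
    congr 1
    refine integral_congr_ae (Eventually.of_forall fun t => ?_)
    have e1 : (y : ℂ) ^ (-(c + t * I : ℂ) - 1) = (y : ℂ) ^ (-c - 1 : ℂ) *
        cexp (-(t * I * (Real.log y : ℝ))) := by
      rw [show (-(c + t * I : ℂ) - 1) = (-c - 1) + -(t * I) by ring, cpow_add _ _ hy0]
      congr 1
      rw [cpow_def_of_ne_zero hy0, ofReal_log (le_of_lt hy)]
      ring_nf
    simp only [e1]
    ring
  refine ContinuousOn.congr ?_ e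
  refine continuousOn_const.mul (ContinuousOn.mul (fun y hy => ?_) ?_)
  · exact (continuousAt_ofReal_cpow_const _ _ (Or.inr (ne_of_gt hy))).continuousWithinAt
  · exact h.comp_continuousOn (Real.continuousOn_log.mono fun y hy => ne_of_gt hy)

/-- The distribution function of `ν` in terms of its Mellin transform. -/
lemma measure_Iic_eq_mellin [SFinite ν] (hpos : ∀ᵐ y ∂ν, 0 < y) (hc : c < 0)
    (hinteg : Integrable (fun y : ℝ => (y : ℂ) ^ (c : ℂ)) ν)
    (hM : Integrable (measureMellin ν c)) {x : ℝ} (hx : 0 < x) :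
    ((ν.real (Iic x) : ℝ) : ℂ) = 1 / (2 * Real.pi : ℂ) * ∫ t : ℝ, (x : ℂ) ^ (-(c + t * I : ℂ)) *
      (measureMellin ν c t * (-(c + t * I : ℂ))⁻¹) := by
  set Φ : ℝ → ℂ := fun x => 1 / (2 * Real.pi : ℂ) * ∫ t : ℝ, (x : ℂ) ^ (-(c + t * I : ℂ)) *
      (measureMellin ν c t * (-(c + t * I : ℂ))⁻¹) with hΦ
  have hfin := measure_Iic_lt_top hpos hc hinteg
  have hmono : Monotone fun x : ℝ => ν.real (Iic x) := fun a b hab =>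
    measureReal_mono (Iic_subset_Iic.2 hab) (hfin b).ne
  have hvert : VerticalIntegrable (mellin fun x : ℝ => ((ν.real (Iic x) : ℝ) : ℂ)) c := by
    simp only [VerticalIntegrable, mellin_measure_Iic hpos hc hinteg]
    refine (hM.norm.mul_const (-c)⁻¹).mono' (hM.aestronglyMeasurable.mul
      (Measurable.aestronglyMeasurable (by fun_prop))) (Eventually.of_forall fun t => ?_)
    rw [norm_mul, norm_inv, norm_neg]
    gcongr
    · linarith
    · have := abs_re_le_norm (c + t * I : ℂ)
      simp only [add_re, ofReal_re, mul_re, I_re, mul_zero, ofReal_im, I_im, mul_one, sub_self,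
        add_zero] at this
      rwa [abs_of_neg hc] at this
  -- Mellin inversion needs continuity at the point, and a distribution function may jump.
  have hcont : ∀ z : ℝ, 0 < z → ContinuousAt (fun x : ℝ => ν.real (Iic x)) z →
      ((ν.real (Iic z) : ℝ) : ℂ) = Φ z := by
    intro z hz hzc
    have h := mellinInv_mellin_eq c (fun x : ℝ => ((ν.real (Iic x) : ℝ) : ℂ)) hz
      (mellinConvergent_measure_Iic hpos hc hinteg) hvert
      (continuous_ofReal.continuousAt.comp hzc)
    rw [← h, mellinInv]
    simp only [mellin_measure_Iic hpos hc hinteg, smul_eq_mul, hΦ, real_smul]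
    push_cast
    rfl
  have hright : Tendsto (fun z : ℝ => ((ν.real (Iic z) : ℝ) : ℂ)) (𝓝[>] x)
      (𝓝 ((ν.real (Iic x) : ℝ) : ℂ)) := by
    have h1 := tendsto_measure_biInter_gt (μ := ν) (s := fun z : ℝ => Iic z) (a := x)
      (fun r _ => measurableSet_Iic.nullMeasurableSet) (fun i j _ hij => Iic_subset_Iic.2 hij)
      ⟨x + 1, by simp, (hfin _).ne⟩
    have h2 : (⋂ r > x, Iic r) = Iic x := by
      ext y
      simp only [mem_iInter, mem_Iic]
      exact ⟨fun h => le_of_forall_gt_imp_ge_of_dense h, fun h r hr => h.trans hr.le⟩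
    rw [h2] at h1
    have h3 := (ENNReal.tendsto_toReal (hfin x).ne).comp h1
    exact (continuous_ofReal.tendsto _).comp h3
  have hΦc : Tendsto Φ (𝓝[>] x) (𝓝 (Φ x)) :=
    (hasDerivAt_mellin_primitive hc hM hx).continuousAt.tendsto.mono_left nhdsWithin_le_nhds
  -- A monotone function is continuous off a countable set, so continuity points accumulate at `x`
  -- from the right, where both sides have the correct limits.
  have hfreq : ∃ᶠ z in 𝓝[>] x, ((ν.real (Iic z) : ℝ) : ℂ) = Φ z := by
    rw [frequently_nhdsWithin_iff, frequently_iff]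
    intro U hU
    obtain ⟨l, u, ⟨hlx, hxu⟩, hsub⟩ := mem_nhds_iff_exists_Ioo_subset.1 hU
    obtain ⟨z, hz', hz⟩ := (hmono.countable_not_continuousAt.dense_compl ℝ).exists_mem_open
      isOpen_Ioo (nonempty_Ioo.2 hxu)
    refine ⟨z, hsub ⟨lt_trans hlx hz.1, hz.2⟩, ?_, hz.1⟩
    exact hcont z (hx.trans hz.1) (not_not.1 hz')
  exact tendsto_nhds_unique_of_frequently_eq hright hΦc hfreq

/-- The density formula is only available away from `0`, so `(0, b]` is exhausted by the intervals
`(1/(n+1), b]`. -/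
lemma measure_ext_of_Ioc_pos {ν₁ ν₂ : Measure ℝ} (h₁ : ∀ᵐ y ∂ν₁, 0 < y) (h₂ : ∀ᵐ y ∂ν₂, 0 < y)
    (hfin : ∀ x, ν₁ (Iic x) < ⊤)
    (h : ∀ a b : ℝ, 0 < a → a < b → ν₁ (Ioc a b) = ν₂ (Ioc a b)) : ν₁ = ν₂ := by
  have key : ∀ m : Measure ℝ, (∀ᵐ y ∂m, 0 < y) → ∀ a b : ℝ, a ≤ 0 →
      m (Ioc a b) = ⨆ n : ℕ, m (Ioc (1 / ((n : ℝ) + 1)) b) := by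
    intro m hm a b ha
    have e1 : m (Ioc a b) = m (Ioc 0 b) := by
      refine measure_congr ?_
      filter_upwards [hm] with y hy
      exact propext ⟨fun hh => ⟨hy, hh.2⟩, fun hh => ⟨ha.trans_lt hy, hh.2⟩⟩
    have e2 : Ioc 0 b = ⋃ n : ℕ, Ioc (1 / ((n : ℝ) + 1)) b := by
      ext y
      simp only [mem_iUnion, mem_Ioc]
      constructor
      · rintro ⟨h0, hb⟩
        obtain ⟨n, hn⟩ := exists_nat_one_div_lt h0
        exact ⟨n, hn, hb⟩
      · rintro ⟨n, hn, hb⟩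
        exact ⟨lt_trans (by positivity) hn, hb⟩
    rw [e1, e2, Monotone.measure_iUnion]
    intro i j hij
    refine Ioc_subset_Ioc_left ?_
    exact Nat.one_div_le_one_div hij
  refine Measure.ext_of_Ioc' _ _ (fun a b _ => ?_) fun a b hab => ?_
  · exact (lt_of_le_of_lt (measure_mono fun y hy => hy.2) (hfin b)).ne
  · rcases lt_or_ge 0 a with ha | ha
    · exact h a b ha hab
    · rw [key ν₁ h₁ a b ha, key ν₂ h₂ a b ha]
      refine iSup_congr fun n => ?_
      rcases lt_or_ge (1 / ((n : ℝ) + 1)) b with hb | hb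
      · exact h _ _ (by positivity) hb
      · rw [Ioc_eq_empty (not_lt.2 hb)]; simp

/-- A measure on `(0, ∞)` whose Mellin transform is integrable along a vertical line has the
density given by the inverse Mellin transform. -/
theorem exists_density_of_integrable_mellin [SFinite ν] (hpos : ∀ᵐ y ∂ν, 0 < y) (hc : c < 0)
    (hinteg : Integrable (fun y : ℝ => (y : ℂ) ^ (c : ℂ)) ν)
    (hM : Integrable (measureMellin ν c)) :
    ∃ g : ℝ → ℝ, Measurable g ∧ (∀ y, 0 < y → 0 ≤ g y ∧ (g y : ℂ) = mellinDensity ν c y) ∧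
      ν = (volume.restrict (Ioi 0)).withDensity fun y => ENNReal.ofReal (g y) := by
  have hfin := measure_Iic_lt_top hpos hc hinteg
  have hmono : Monotone fun x : ℝ => ν.real (Iic x) := fun a b hab =>
    measureReal_mono (Iic_subset_Iic.2 hab) (hfin b).ne
  have hderiv : ∀ y : ℝ, 0 < y → HasDerivAt (fun x : ℝ => ((ν.real (Iic x) : ℝ) : ℂ))
      (mellinDensity ν c y) y := by
    intro y hy
    refine (hasDerivAt_mellin_primitive hc hM hy).congr_of_eventuallyEq ?_
    filter_upwards [lt_mem_nhds hy] with z hz using measure_Iic_eq_mellin hpos hc hinteg hM hz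
  have hre : ∀ y : ℝ, 0 < y → HasDerivAt (fun x : ℝ => ν.real (Iic x))
      (mellinDensity ν c y).re y := fun y hy => by
    simpa [Function.comp_def] using (reCLM.hasFDerivAt.comp_hasDerivAt y (hderiv y hy))
  -- The density is the derivative of a real increasing function: hence real here, and nonnegative
  -- below.
  have him : ∀ y : ℝ, 0 < y → (mellinDensity ν c y).im = 0 := fun y hy => by
    have h1 := (imCLM.hasFDerivAt.comp_hasDerivAt y (hderiv y hy))
    have h2 : HasDerivAt (fun _ : ℝ => (0 : ℝ)) (mellinDensity ν c y).im y := by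
      simpa [Function.comp_def] using h1
    exact h2.unique (hasDerivAt_const y 0)
  have hcont : ContinuousOn (fun y => (mellinDensity ν c y).re) (Ioi 0) :=
    continuous_re.comp_continuousOn (continuousOn_mellinDensity hM)
  set g : ℝ → ℝ := (Ioi 0).indicator fun y => (mellinDensity ν c y).re with hg
  have hgm : Measurable g := by
    classical
    rw [hg, ← piecewise_eq_indicator]
    exact hcont.measurable_piecewise continuous_zero.continuousOn measurableSet_Ioi
  have hge : ∀ y, 0 < y → g y = (mellinDensity ν c y).re := fun y hy =>
    indicator_of_mem (mem_Ioi.2 hy) _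
  have hgnn : ∀ y, 0 < y → 0 ≤ g y := fun y hy => by
    rw [hge y hy]; exact (hre y hy).nonneg_of_monotone hmono
  refine ⟨g, hgm, fun y hy => ⟨hgnn y hy, ?_⟩, ?_⟩
  · rw [hge y hy]
    exact Complex.ext (by simp) (by simp [him y hy])
  · refine measure_ext_of_Ioc_pos hpos ?_ hfin fun a b ha hab => ?_
    · exact (withDensity_absolutelyContinuous _ _).ae_le (ae_restrict_mem measurableSet_Ioi)
    · have hsub : Ioc a b ∩ Ioi 0 = Ioc a b := inter_eq_left.2 fun y hy => ha.trans hy.1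
      have hIcc : uIcc a b ⊆ Ioi 0 := by
        rw [uIcc_of_le hab.le]; exact fun y hy => ha.trans_le hy.1
      have hii : IntervalIntegrable (fun y => (mellinDensity ν c y).re) volume a b :=
        (hcont.mono hIcc).intervalIntegrable
      have hFTC := intervalIntegral.integral_eq_sub_of_hasDerivAt
        (fun y hy => hre y (hIcc hy)) hii
      rw [intervalIntegral.integral_of_le hab.le] at hFTC
      rw [withDensity_apply _ measurableSet_Ioc, Measure.restrict_restrict measurableSet_Ioc, hsub,
        setLIntegral_congr_fun (g := fun y => ENNReal.ofReal (mellinDensity ν c y).re)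
          measurableSet_Ioc (fun y hy => by simp only [hge y (ha.trans hy.1)]),
        ← ofReal_integral_eq_lintegral_ofReal ((intervalIntegrable_iff_integrableOn_Ioc_of_le
          hab.le).1 hii), hFTC]
      · rw [← measureReal_sdiff (Iic_subset_Iic.2 hab.le) measurableSet_Iic (hfin b).ne, Iic_sdiff_Iic,
          measureReal_def, ENNReal.ofReal_toReal]
        exact (lt_of_le_of_lt (measure_mono fun y hy => hy.2) (hfin b)).ne
      · filter_upwards [ae_restrict_mem measurableSet_Ioc] with y hy
        have := hgnn y (ha.trans hy.1)
        rwa [hge y (ha.trans hy.1)] at this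

end MellinDensity

/-! ### Linear change of contour variables. -/

section ContourCoordinates

open Complex Set Filter Topology

/-- Coordinates on `ℝ⁴` in which the Mellin–Barnes integrand is almost a product. -/
noncomputable def contourCoord : ((ℝ × ℝ) × (ℝ × ℝ)) ≃ᵐ (Fin 4 → ℝ) where
  toFun p := ![p.1.1, -p.2.1 - p.1.2, p.2.1 + (p.1.1 - p.2.1 - p.1.2) / 2, p.2.2]
  invFun f := ((f 0, (f 0 - f 1) / 2 - f 2), (f 2 - (f 0 + f 1) / 2, f 3))
  left_inv p := by
    obtain ⟨⟨a, b⟩, ⟨c, d⟩⟩ := p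
    ext <;> simp <;> ring
  right_inv f := by
    ext i
    fin_cases i <;> simp <;> ring
  measurable_toFun := by
    refine measurable_pi_lambda _ fun i => ?_
    fin_cases i <;> simp <;> fun_prop
  measurable_invFun := by
    simp only [Equiv.coe_fn_symm_mk]
    fun_prop

lemma measurePreserving_vec4 :
    MeasurePreserving (fun p : (ℝ × ℝ) × (ℝ × ℝ) => (![p.1.1, p.1.2, p.2.1, p.2.2] : Fin 4 → ℝ)) := by
  have hm : Measurable (fun p : (ℝ × ℝ) × (ℝ × ℝ) =>
      (![p.1.1, p.1.2, p.2.1, p.2.2] : Fin 4 → ℝ)) := by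
    refine measurable_pi_lambda _ fun i => ?_
    fin_cases i <;> simp <;> fun_prop
  refine ⟨hm, ?_⟩
  refine (Measure.pi_eq fun s hs => ?_).symm
  rw [Measure.map_apply hm (MeasurableSet.univ_pi hs)]
  have : (fun p : (ℝ × ℝ) × (ℝ × ℝ) => (![p.1.1, p.1.2, p.2.1, p.2.2] : Fin 4 → ℝ)) ⁻¹'
      (univ.pi s) = (s 0 ×ˢ s 1) ×ˢ (s 2 ×ˢ s 3) := by
    ext p
    simp [Set.mem_pi, Fin.forall_fin_succ, and_assoc]
  rw [this, Measure.volume_eq_prod, Measure.prod_prod, Measure.volume_eq_prod, Measure.prod_prod,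
    Measure.prod_prod, Fin.prod_univ_four]
  ring

/-- The change of variables is linear with determinant `-1`, so no Jacobian appears. -/
lemma measurePreserving_contourCoord : MeasurePreserving contourCoord := by
  set M : Matrix (Fin 4) (Fin 4) ℝ :=
    !![1, 0, 0, 0; 0, -1, -1, 0; 1/2, -1/2, 1/2, 0; 0, 0, 0, 1] with hM
  have hdet : M.det = -1 := by
    simp [hM, Matrix.det_succ_row_zero, Fin.sum_univ_succ, Fin.succAbove]
    norm_num
  have hlin : MeasurePreserving (Matrix.toLin' M) := by
    refine ⟨(LinearMap.continuous_of_finiteDimensional _).measurable, ?_⟩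
    rw [Real.map_matrix_volume_pi_eq_smul_volume_pi (by rw [hdet]; norm_num), hdet]
    simp
  have hcomp : ⇑contourCoord = Matrix.toLin' M ∘ fun p : (ℝ × ℝ) × (ℝ × ℝ) =>
      (![p.1.1, p.1.2, p.2.1, p.2.2] : Fin 4 → ℝ) := by
    ext p i
    fin_cases i <;>
      simp [contourCoord, hM, Matrix.toLin'_apply, Matrix.mulVec, dotProduct, Fin.sum_univ_succ] <;>
      ring
  rw [hcomp]
  exact hlin.comp measurePreserving_vec4

lemma contourPoint_contourCoord (c : Fin 4 → ℝ) (p : (ℝ × ℝ) × (ℝ × ℝ)) {S W V R : ℂ}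
    (hS : S = c 0 + p.1.1 * I) (hW : W = ((c 0 - c 1) / 2 - c 2 : ℝ) + p.1.2 * I)
    (hV : V = (c 2 - (c 0 + c 1) / 2 : ℝ) + p.2.1 * I) (hR : R = c 3 + p.2.2 * I) :
    contourPoint c (contourCoord p) = ![S, -(V + W), V + (S - V - W) / 2, R] := by
  subst hS hW hV hR
  ext i
  fin_cases i <;> simp [contourPoint, contourCoord] <;> ring

/-- The new variables are gamma arguments: `W = (s₁-s₂)/2 - s₃`, `V = s₃ - (s₁+s₂)/2`, with `S = s₁`
and `R = s₄`. The three groups are the coupled `(S, W)` factor, a product in `V` and `R`, and what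
the space integral of `mbKernel` produces. -/
lemma callIntegrand_eq (βp βm lamSum b Ap Am κ : ℝ) (S W V R : ℂ) :
    callIntegrand βp βm lamSum b Ap Am (-κ) ![S, -(V + W), V + (S - V - W) / 2, R] =
      (Gamma (-S / βp) * (Gamma (-S))⁻¹ * (Gamma (1 + S))⁻¹ * (Gamma W * Gamma (1 + S - W)) *
        (Ap : ℂ) ^ (S / βp)) *
      ((Gamma V * (lamSum : ℂ) ^ (-V)) * (Gamma R * (b : ℂ) ^ (-R))) *
      (((Am : ℂ) ^ (-((V + W) / βm)) * Gamma ((V + W) / βm) / Gamma (V + W)) *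
        ((κ : ℂ) ^ (-(S - W + R)) / (S - W + R))) := by
  have e1 : (S + -(V + W)) / 2 - (V + (S - V - W) / 2) = -V := by ring
  have e2 : -((S + -(V + W)) / 2) - (V + (S - V - W) / 2) - R = -(S - W + R) := by ring
  have e3 : (S + -(V + W)) / 2 + (V + (S - V - W) / 2) + R = S - W + R := by ring
  have e4 : -(V + W) / (βm : ℂ) = -((V + W) / βm) := by ring
  have hn : ((matU βp βm).map Complex.ofReal *ᵥ ![S, -(V + W), V + (S - V - W) / 2, R]
      + fun i => (vecU i : ℂ)) = ![V, 1 + S - W, W, -S / βp, (V + W) / βm, R] := by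
    ext i
    fin_cases i <;>
      simp [matU, vecU, Matrix.mulVec, dotProduct, Fin.sum_univ_succ] <;> ring
  have hd : (matD.map Complex.ofReal *ᵥ ![S, -(V + W)] + fun i => (vecD i : ℂ))
      = ![1 + S, -S, V + W] := by
    ext i
    fin_cases i <;>
      simp [matD, vecD, Matrix.mulVec, dotProduct, Fin.sum_univ_succ]; ring
  rw [callIntegrand, gammaQuot, neg_neg]
  simp only [Matrix.cons_val_zero, Matrix.cons_val_one, Matrix.cons_val]
  rw [hn, hd, e1, e2, e3, e4, Fin.prod_univ_six, Fin.prod_univ_three]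
  simp only [Matrix.cons_val_zero, Matrix.cons_val_one, Matrix.cons_val]
  simp only [div_eq_mul_inv, mul_inv]
  ring

end ContourCoordinates

/-! ### Exchange of the contour and space integrals. -/

section Fubini

open Complex Set Filter Topology

/-- The point `c + i y` of a vertical line. -/
abbrev vline (c y : ℝ) : ℂ := c + y * I

lemma vline_re (c y : ℝ) : (vline c y).re = c := by simp [vline]

variable {νm νp : Measure ℝ} {c₁ cW cV c₄ κ : ℝ}

/-- The kernel linking the contour variables `p` with the space variables `q = (z, x)`. -/
noncomputable def mbKernel (c₁ cW cV c₄ : ℝ) (p : (ℝ × ℝ) × (ℝ × ℝ)) (q : ℝ × ℝ) : ℂ :=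
  (q.1 : ℂ) ^ (-(vline cV p.2.1 + vline cW p.1.2)) *
    (q.2 : ℂ) ^ (-(vline c₁ p.1.1 - vline cW p.1.2 + vline c₄ p.2.2) - 1)

lemma ae_pos_prod [SFinite νm] (hpos : ∀ᵐ z ∂νm, 0 < z) (hκ : 0 < κ) :
    ∀ᵐ q : ℝ × ℝ ∂(νm.prod (volume.restrict (Ioi κ))), 0 < q.1 ∧ 0 < q.2 := by
  have h1 : ∀ᵐ q : ℝ × ℝ ∂(νm.prod (volume.restrict (Ioi κ))), 0 < q.1 :=
    Measure.quasiMeasurePreserving_fst.ae hpos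
  have h2 : ∀ᵐ q : ℝ × ℝ ∂(νm.prod (volume.restrict (Ioi κ))), q.2 ∈ Ioi κ :=
    Measure.quasiMeasurePreserving_snd.ae (ae_restrict_mem measurableSet_Ioi)
  filter_upwards [h1, h2] with q hq1 hq2
  exact ⟨hq1, hκ.trans hq2⟩

lemma norm_mbKernel {p : (ℝ × ℝ) × (ℝ × ℝ)} {q : ℝ × ℝ} (h1 : 0 < q.1) (h2 : 0 < q.2) :
    ‖mbKernel c₁ cW cV c₄ p q‖ = q.1 ^ (-(cV + cW)) * q.2 ^ (-(c₁ - cW + c₄) - 1) := by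
  rw [mbKernel, norm_mul, norm_cpow_eq_rpow_re_of_pos h1, norm_cpow_eq_rpow_re_of_pos h2]
  simp

/-- The modulus of the kernel depends only on the real parts of the contours, so the dominating
function is a product of the contour weight and powers of `z` and `x`. -/
lemma integrable_mbKernel [SFinite νm] (hpos : ∀ᵐ z ∂νm, 0 < z) (hκ : 0 < κ)
    (hθ : 0 < c₁ - cW + c₄)
    (hν : Integrable (fun z : ℝ => (z : ℂ) ^ (-((cV + cW : ℝ) : ℂ))) νm)
    {F : (ℝ × ℝ) × (ℝ × ℝ) → ℂ} (hF : Integrable F) :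
    Integrable (fun P : ((ℝ × ℝ) × (ℝ × ℝ)) × (ℝ × ℝ) => F P.1 * mbKernel c₁ cW cV c₄ P.1 P.2)
      (volume.prod (νm.prod (volume.restrict (Ioi κ)))) := by
  have h1 : Integrable (fun z : ℝ => z ^ (-(cV + cW))) νm := by
    refine hν.norm.congr ?_
    filter_upwards [hpos] with z hz
    rw [norm_cpow_eq_rpow_re_of_pos hz]
    simp
  have h2 : Integrable (fun x : ℝ => x ^ (-(c₁ - cW + c₄) - 1)) (volume.restrict (Ioi κ)) :=
    integrableOn_Ioi_rpow_of_lt (by linarith) hκ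
  have hmeas : Measurable (fun P : ((ℝ × ℝ) × (ℝ × ℝ)) × (ℝ × ℝ) =>
      mbKernel c₁ cW cV c₄ P.1 P.2) := by
    unfold mbKernel vline
    fun_prop
  refine (hF.norm.mul_prod (h1.mul_prod h2)).mono'
    (hF.aestronglyMeasurable.comp_fst.mul hmeas.aestronglyMeasurable) ?_
  have h3 : ∀ᵐ P : ((ℝ × ℝ) × (ℝ × ℝ)) × (ℝ × ℝ)
      ∂(volume.prod (νm.prod (volume.restrict (Ioi κ)))), 0 < P.2.1 ∧ 0 < P.2.2 :=
    Measure.quasiMeasurePreserving_snd.ae (ae_pos_prod hpos hκ)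
  filter_upwards [h3] with P hP
  rw [norm_mul, norm_mbKernel hP.1 hP.2]

lemma integral_mbKernel_space [SFinite νm] (hκ : 0 < κ) (hθ : 0 < c₁ - cW + c₄)
    (p : (ℝ × ℝ) × (ℝ × ℝ)) :
    ∫ q, mbKernel c₁ cW cV c₄ p q ∂(νm.prod (volume.restrict (Ioi κ))) =
      (∫ z : ℝ, (z : ℂ) ^ (-(vline cV p.2.1 + vline cW p.1.2)) ∂νm) *
      ((κ : ℂ) ^ (-(vline c₁ p.1.1 - vline cW p.1.2 + vline c₄ p.2.2)) /
        (vline c₁ p.1.1 - vline cW p.1.2 + vline c₄ p.2.2)) := by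
  unfold mbKernel
  rw [integral_prod_mul (fun z : ℝ => (z : ℂ) ^ (-(vline cV p.2.1 + vline cW p.1.2)))
    (fun x : ℝ => (x : ℂ) ^ (-(vline c₁ p.1.1 - vline cW p.1.2 + vline c₄ p.2.2) - 1)),
    integral_Ioi_cpow_of_lt _ hκ, sub_add_cancel, div_neg, neg_div, neg_neg]
  simp [vline]
  linarith

lemma integral_mbKernel_contour {a : ℝ × ℝ → ℂ} {q : ℝ × ℝ} {f g : ℝ → ℂ} (h1 : 0 < q.1)
    (h2 : 0 < q.2) :
    ∫ p : (ℝ × ℝ) × (ℝ × ℝ), (a p.1 * (f p.2.1 * g p.2.2)) * mbKernel c₁ cW cV c₄ p q =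
      (∫ p : ℝ × ℝ, a p * ((q.1 : ℂ) ^ (-vline cW p.2) *
        (q.2 : ℂ) ^ (-(vline c₁ p.1 - vline cW p.2) - 1))) *
      ((∫ v : ℝ, f v * (q.1 : ℂ) ^ (-vline cV v)) * ∫ u : ℝ, g u * (q.2 : ℂ) ^ (-vline c₄ u)) := by
  have hz : (q.1 : ℂ) ≠ 0 := ofReal_ne_zero.2 h1.ne'
  have hx : (q.2 : ℂ) ≠ 0 := ofReal_ne_zero.2 h2.ne'
  rw [← integral_prod_mul (fun v : ℝ => f v * (q.1 : ℂ) ^ (-vline cV v))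
    (fun u : ℝ => g u * (q.2 : ℂ) ^ (-vline c₄ u)), Measure.volume_eq_prod (ℝ × ℝ) (ℝ × ℝ),
    ← integral_prod_mul (fun p : ℝ × ℝ => a p * ((q.1 : ℂ) ^ (-vline cW p.2) *
        (q.2 : ℂ) ^ (-(vline c₁ p.1 - vline cW p.2) - 1)))]
  refine integral_congr_ae (Eventually.of_forall fun p => ?_)
  simp only [mbKernel]
  rw [neg_add, cpow_add _ _ hz, show -(vline c₁ p.1.1 - vline cW p.1.2 + vline c₄ p.2.2) - 1 =
    (-(vline c₁ p.1.1 - vline cW p.1.2) - 1) + -vline c₄ p.2.2 by ring, cpow_add _ _ hx]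
  ring

/-- The factor of the integrand coupling two contour variables. -/
noncomputable def coupledFactor (M : ℝ → ℂ) (c₁ cW : ℝ) (p : ℝ × ℝ) : ℂ :=
  M p.1 * ((Gamma (1 + vline c₁ p.1))⁻¹ * (Gamma (vline cW p.2) *
    Gamma (1 + vline c₁ p.1 - vline cW p.2)))

/-- The `w`-integral is the binomial one at `v = z/x`: it cancels `1/Γ(1+S)` and assembles
`(x+z)^{-S-1}`. The remaining integral is the inverse Mellin integral defining the density. -/
lemma integral_coupledFactor (hW : 0 < cW) (hW1 : cW < 1 + c₁) {z x : ℝ} (hz : 0 < z)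
    (hx : 0 < x) (ha : Integrable (coupledFactor (measureMellin νp c₁) c₁ cW)) :
    ∫ p : ℝ × ℝ, coupledFactor (measureMellin νp c₁) c₁ cW p * ((z : ℂ) ^ (-vline cW p.2) *
        (x : ℂ) ^ (-(vline c₁ p.1 - vline cW p.2) - 1)) =
      (2 * Real.pi) ^ 2 * mellinDensity νp c₁ (x + z) := by
  have hzc : (z : ℂ) ≠ 0 := ofReal_ne_zero.2 hz.ne'
  have hxc : (x : ℂ) ≠ 0 := ofReal_ne_zero.2 hx.ne'
  have hinteg : Integrable (fun p : ℝ × ℝ => coupledFactor (measureMellin νp c₁) c₁ cW p *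
      ((z : ℂ) ^ (-vline cW p.2) * (x : ℂ) ^ (-(vline c₁ p.1 - vline cW p.2) - 1))) := by
    refine (ha.norm.mul_const (z ^ (-cW) * x ^ (-(c₁ - cW) - 1))).mono'
      (ha.aestronglyMeasurable.mul (Measurable.aestronglyMeasurable (by unfold vline; fun_prop)))
      (Eventually.of_forall fun p => ?_)
    rw [norm_mul, norm_mul, norm_cpow_eq_rpow_re_of_pos hz, norm_cpow_eq_rpow_re_of_pos hx]
    simp
  rw [Measure.volume_eq_prod, integral_prod _ hinteg]
  have hinner : ∀ y : ℝ, ∫ w : ℝ, coupledFactor (measureMellin νp c₁) c₁ cW (y, w) *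
      ((z : ℂ) ^ (-vline cW w) * (x : ℂ) ^ (-(vline c₁ y - vline cW w) - 1)) =
      (2 * Real.pi) * (measureMellin νp c₁ y * ((x + z : ℝ) : ℂ) ^ (-(vline c₁ y) - 1)) := by
    intro y
    have hre : (1 + vline c₁ y).re = 1 + c₁ := by simp [vline]
    have hG : Gamma (1 + vline c₁ y) ≠ 0 := Gamma_ne_zero_of_re_pos (by rw [hre]; linarith)
    have e : ∀ w : ℝ, coupledFactor (measureMellin νp c₁) c₁ cW (y, w) *
        ((z : ℂ) ^ (-vline cW w) * (x : ℂ) ^ (-(vline c₁ y - vline cW w) - 1)) =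
        (measureMellin νp c₁ y * (Gamma (1 + vline c₁ y))⁻¹ * (x : ℂ) ^ (-(vline c₁ y) - 1)) *
        (Gamma (cW + w * I) * Gamma (1 + vline c₁ y - (cW + w * I)) *
          ((z / x : ℝ) : ℂ) ^ (-(cW + w * I : ℂ))) := by
      intro w
      have e1 : (z : ℂ) ^ (-vline cW w) = ((z / x : ℝ) : ℂ) ^ (-vline cW w) *
          (x : ℂ) ^ (-vline cW w) := by
        rw [← mul_cpow_ofReal_nonneg (by positivity) hx.le, ← ofReal_mul, div_mul_cancel₀ _ hx.ne']
      have e2 : (x : ℂ) ^ (-(vline c₁ y - vline cW w) - 1) = (x : ℂ) ^ (-(vline c₁ y) - 1) *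
          (x : ℂ) ^ (vline cW w) := by
        rw [← cpow_add _ _ hxc]; congr 1; ring
      have e3 : (x : ℂ) ^ (-vline cW w) * (x : ℂ) ^ (vline cW w) = 1 := by
        rw [← cpow_add _ _ hxc]; simp
      simp only [coupledFactor]
      rw [e1, e2]
      linear_combination (measureMellin νp c₁ y * ((Gamma (1 + vline c₁ y))⁻¹ *
        (Gamma (vline cW w) * Gamma (1 + vline c₁ y - vline cW w))) *
        ((z / x : ℝ) : ℂ) ^ (-vline cW w) * (x : ℂ) ^ (-(vline c₁ y) - 1)) * e3
    simp_rw [e]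
    rw [integral_const_mul, integral_Gamma_mul_Gamma_mul_cpow_neg hW (by rw [hre]; exact hW1)
      (by positivity)]
    have e4 : ((x + z : ℝ) : ℂ) ^ (-(vline c₁ y) - 1) = (x : ℂ) ^ (-(vline c₁ y) - 1) *
        ((1 + z / x : ℝ) : ℂ) ^ (-(1 + vline c₁ y)) := by
      rw [show -(1 + vline c₁ y) = -(vline c₁ y) - 1 by ring,
        ← mul_cpow_ofReal_nonneg hx.le (by positivity), ← ofReal_mul]
      congr 2
      field_simp
    rw [e4]
    field_simp
  simp_rw [hinner]
  rw [integral_const_mul, mellinDensity]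
  have : (Real.pi : ℂ) ≠ 0 := ofReal_ne_zero.2 Real.pi_ne_zero
  generalize (∫ y : ℝ, measureMellin νp c₁ y * ((x + z : ℝ) : ℂ) ^ (-(c₁ + y * I : ℂ) - 1)) = J
  field_simp

lemma integral_Gamma_mul_cpow_mul_cpow {σ A x : ℝ} (hσ : 0 < σ) (hA : 0 < A) (hx : 0 < x) :
    ∫ y : ℝ, (Gamma (vline σ y) * (A : ℂ) ^ (-vline σ y)) * (x : ℂ) ^ (-vline σ y)
      = 2 * Real.pi * (Real.exp (-(A * x)) : ℂ) := by
  rw [← integral_Gamma_mul_cpow_neg hσ (mul_pos hA hx)]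
  refine integral_congr_ae (Eventually.of_forall fun y => ?_)
  simp only [vline]
  rw [ofReal_mul, mul_cpow_ofReal_nonneg hA.le hx.le, mul_assoc]

lemma integrable_Gamma_mul_cpow {σ A : ℝ} (hσ : 0 < σ) (hA : 0 < A) :
    Integrable fun y : ℝ => Gamma (vline σ y) * (A : ℂ) ^ (-vline σ y) := by
  refine ((integrable_Gamma_vertical hσ).norm.mul_const (A ^ (-σ))).mono'
    ((integrable_Gamma_vertical hσ).aestronglyMeasurable.mul
      (Measurable.aestronglyMeasurable (by unfold vline; fun_prop)))
    (Eventually.of_forall fun y => ?_)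
  rw [norm_mul, norm_cpow_eq_rpow_re_of_pos hA]
  simp [vline]

/-- The Mellin–Barnes representation of a truncated double integral. -/
theorem mb_representation [SFinite νm] (hpos : ∀ᵐ z ∂νm, 0 < z) (hκ : 0 < κ)
    (hθ : 0 < c₁ - cW + c₄) (hW : 0 < cW) (hW1 : cW < 1 + c₁) (hV : 0 < cV) (h4 : 0 < c₄)
    {lamSum b : ℝ} (hlam : 0 < lamSum) (hb : 0 < b)
    (hν : Integrable (fun z : ℝ => (z : ℂ) ^ (-((cV + cW : ℝ) : ℂ))) νm)
    (ha : Integrable (coupledFactor (measureMellin νp c₁) c₁ cW))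
    {G : (ℝ × ℝ) × (ℝ × ℝ) → ℂ}
    (hG : ∀ p, G p = coupledFactor (measureMellin νp c₁) c₁ cW p.1 *
      ((Gamma (vline cV p.2.1) * (lamSum : ℂ) ^ (-vline cV p.2.1)) *
        (Gamma (vline c₄ p.2.2) * (b : ℂ) ^ (-vline c₄ p.2.2))) *
      ((∫ z : ℝ, (z : ℂ) ^ (-(vline cV p.2.1 + vline cW p.1.2)) ∂νm) *
      ((κ : ℂ) ^ (-(vline c₁ p.1.1 - vline cW p.1.2 + vline c₄ p.2.2)) /
        (vline c₁ p.1.1 - vline cW p.1.2 + vline c₄ p.2.2)))) :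
    Integrable G ∧ Integrable (fun q : ℝ × ℝ => mellinDensity νp c₁ (q.2 + q.1) *
        (Real.exp (-(lamSum * q.1)) * Real.exp (-(b * q.2)) : ℂ))
        (νm.prod (volume.restrict (Ioi κ))) ∧
      ∫ p, G p = (2 * Real.pi) ^ 4 *
        ∫ q : ℝ × ℝ, mellinDensity νp c₁ (q.2 + q.1) *
          (Real.exp (-(lamSum * q.1)) * Real.exp (-(b * q.2)) : ℂ)
          ∂(νm.prod (volume.restrict (Ioi κ))) := by
  set F : (ℝ × ℝ) × (ℝ × ℝ) → ℂ := fun p => coupledFactor (measureMellin νp c₁) c₁ cW p.1 *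
      ((Gamma (vline cV p.2.1) * (lamSum : ℂ) ^ (-vline cV p.2.1)) *
        (Gamma (vline c₄ p.2.2) * (b : ℂ) ^ (-vline c₄ p.2.2))) with hFdef
  have hF : Integrable F := ha.mul_prod
    ((integrable_Gamma_mul_cpow hV hlam).mul_prod (integrable_Gamma_mul_cpow h4 hb))
  -- One application of Fubini to all six variables: `hspace` is the inner integral in one order,
  -- `hcont` in the other.
  have hK := integrable_mbKernel (κ := κ) hpos hκ hθ hν hF
  have hspace : ∀ p, ∫ q, F p * mbKernel c₁ cW cV c₄ p q ∂(νm.prod (volume.restrict (Ioi κ)))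
      = G p := fun p => by
    rw [integral_const_mul, integral_mbKernel_space hκ hθ, hG]
  have hcont : ∀ᵐ q ∂(νm.prod (volume.restrict (Ioi κ))), ∫ p, F p * mbKernel c₁ cW cV c₄ p q
      = (2 * Real.pi) ^ 4 * (mellinDensity νp c₁ (q.2 + q.1) *
        (Real.exp (-(lamSum * q.1)) * Real.exp (-(b * q.2)) : ℂ)) := by
    filter_upwards [ae_pos_prod hpos hκ] with q hq
    rw [integral_mbKernel_contour (a := coupledFactor (measureMellin νp c₁) c₁ cW)
      (f := fun v => Gamma (vline cV v) * (lamSum : ℂ) ^ (-vline cV v))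
      (g := fun u => Gamma (vline c₄ u) * (b : ℂ) ^ (-vline c₄ u)) hq.1 hq.2,
      integral_coupledFactor hW hW1 hq.1 hq.2 ha, integral_Gamma_mul_cpow_mul_cpow hV hlam hq.1,
      integral_Gamma_mul_cpow_mul_cpow h4 hb hq.2]
    ring
  have hpi : ((2 * Real.pi) ^ 4 : ℂ) ≠ 0 := by
    simp [Real.pi_ne_zero]
  refine ⟨?_, ?_, ?_⟩
  · refine hK.integral_prod_left.congr (Eventually.of_forall fun p => ?_)
    exact hspace p
  · have := ((hK.integral_prod_right).congr hcont).const_mul ((2 * Real.pi) ^ 4 : ℂ)⁻¹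
    simpa only [← mul_assoc, inv_mul_cancel₀ hpi, one_mul] using this
  · have hswap := integral_integral_swap (f := fun p q => F p * mbKernel c₁ cW cV c₄ p q) hK
    rw [integral_congr_ae hcont, integral_const_mul] at hswap
    rw [← hswap]
    exact integral_congr_ae (Eventually.of_forall fun p => (hspace p).symm)

end Fubini

/-! ### Truncated exponential moments of the two-sided law. -/

section TruncatedMoments

open Complex Set Filter Topology

lemma conv_map_neg (μ ν : Measure ℝ) [SFinite μ] [SFinite ν] :
    μ.conv (ν.map fun x => -x) = (μ.prod ν).map fun p => p.1 - p.2 := by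
  have h : μ.prod (ν.map fun x => -x) = (μ.prod ν).map (Prod.map id fun x => -x) := by
    conv_lhs => rw [← Measure.map_id (μ := μ)]
    exact Measure.map_prod_map _ _ measurable_id measurable_neg
  rw [Measure.conv, h, Measure.map_map (by fun_prop) (by fun_prop)]
  rfl

/-- The truncated exponential `e ^ (s x) 1_{x > κ}`. -/
noncomputable def truncExp (κ s x : ℝ) : ℝ := (Ioi κ).indicator (fun x => Real.exp (s * x)) x

lemma measurable_truncExp (κ s : ℝ) : Measurable (truncExp κ s) :=
  Measurable.indicator (by fun_prop) measurableSet_Ioi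

lemma norm_truncExp_le (κ s x : ℝ) : ‖truncExp κ s x‖ ≤ Real.exp (s * x) := by
  by_cases hx : x ∈ Ioi κ
  · rw [truncExp, indicator_of_mem hx, Real.norm_of_nonneg (Real.exp_pos _).le]
  · rw [truncExp, indicator_of_notMem hx, norm_zero]; positivity

variable {μp μm : Measure ℝ} {αp βp lamp αm βm lamm : ℝ}

/-- Dropping the truncation leaves a product in `y` and `z`. The `z`-factor is at most `1` because
`b ≤ lamp`, and the `y`-factor is integrable because `b > 0`. -/
lemma integrable_truncExp_sub (hp : IsTSPlus μp αp βp lamp) (hm : IsTSPlus μm αm βm lamm)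
    (hαp : 0 < αp) (hβp : 0 < βp) (hβp1 : βp < 1) (hlamp : 0 < lamp) {b : ℝ} (hb : 0 < b)
    (hbl : b ≤ lamp) (κ : ℝ) :
    Integrable (fun p : ℝ × ℝ => truncExp κ (lamp - b) (p.1 - p.2)) (μp.prod μm) := by
  have h1 := hp.isProb
  have h2 := hm.isProb
  have h3 : Integrable (fun z => Real.exp (-((lamp - b) * z))) μm := by
    refine (integrable_const (1 : ℝ)).mono' (by fun_prop) ?_
    filter_upwards [hm.ae_nonneg] with z hz
    rw [Real.norm_of_nonneg (Real.exp_pos _).le, Real.exp_le_one_iff, neg_nonpos]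
    exact mul_nonneg (by linarith) hz
  refine ((hp.integrable_exp hαp hβp hβp1 hlamp hb).mul_prod h3).mono'
    ((measurable_truncExp _ _).comp (by fun_prop)).aestronglyMeasurable
    (Eventually.of_forall fun p => ?_)
  refine (norm_truncExp_le _ _ _).trans_eq ?_
  rw [← Real.exp_add]
  congr 1
  ring

lemma integral_withDensity_ofReal {m : Measure ℝ} {g : ℝ → ℝ} (hg : Measurable g) (f : ℝ → ℂ) :
    ∫ y, f y ∂(m.withDensity fun y => ENNReal.ofReal (g y)) =
      ∫ y, ((max (g y) 0 : ℝ) : ℂ) * f y ∂m := by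
  have h : (m.withDensity fun y => ENNReal.ofReal (g y)) =
      m.withDensity fun y => ((g y).toNNReal : ENNReal) := rfl
  rw [h, integral_withDensity_eq_integral_smul (by fun_prop)]
  refine integral_congr_ae (Eventually.of_forall fun y => ?_)
  simp only [NNReal.smul_def, Real.coe_toNNReal', real_smul]

/-- The inner integral of the truncated double integral, as an integral against `μ`. -/
lemma integral_density_shift {μ : Measure ℝ} {lam b κ z : ℝ} {g : ℝ → ℝ} (hg : Measurable g)
    (hg0 : ∀ y, 0 < y → 0 ≤ g y)
    (hμ : expTilt μ lam = (volume.restrict (Ioi 0)).withDensity fun y => ENNReal.ofReal (g y))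
    (hκ : 0 < κ) (hz : 0 < z) :
    ∫ x in Ioi κ, (g (x + z) : ℂ) * (Real.exp (-(b * x)) : ℂ) =
      (Real.exp (lam * z) : ℂ) * ∫ y, (truncExp κ (lam - b) (y - z) : ℂ) ∂μ := by
  set h : ℝ → ℂ := fun y => (truncExp κ (-b) (y - z) : ℂ) with hh
  have h1 : ∫ y, h y ∂(expTilt μ lam)
      = (Real.exp (lam * z) : ℂ) * ∫ y, (truncExp κ (lam - b) (y - z) : ℂ) ∂μ := by
    rw [integral_expTilt, ← integral_const_mul]
    refine integral_congr_ae (Eventually.of_forall fun y => ?_)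
    simp only [hh]
    rw [← ofReal_mul, ← ofReal_mul, ofReal_inj]
    by_cases hy : y - z ∈ Ioi κ
    · simp only [truncExp, indicator_of_mem hy]
      rw [← Real.exp_add, ← Real.exp_add]
      congr 1
      ring
    · simp only [truncExp, indicator_of_notMem hy, mul_zero]
  -- The tilt absorbs `e^{lam y}`, leaving the exponent `-b`; translation by `z` then matches the
  -- two integrands.
  rw [← h1, hμ, integral_withDensity_ofReal hg, ← integral_indicator measurableSet_Ioi,
    ← integral_indicator measurableSet_Ioi,
    ← integral_add_right_eq_self ((Ioi 0).indicator fun y => ((max (g y) 0 : ℝ) : ℂ) * h y) z]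
  refine integral_congr_ae (Eventually.of_forall fun x => ?_)
  simp only
  by_cases hx : x ∈ Ioi κ
  · have hx0 : 0 < x + z := add_pos (hκ.trans hx) hz
    rw [indicator_of_mem hx, indicator_of_mem (mem_Ioi.2 hx0)]
    simp only [hh, add_sub_cancel_right, truncExp, indicator_of_mem hx]
    rw [max_eq_left (hg0 _ hx0), neg_mul]
  · rw [indicator_of_notMem hx]
    by_cases hx0 : x + z ∈ Ioi (0 : ℝ)
    · rw [indicator_of_mem hx0]
      simp [hh, truncExp, indicator_of_notMem hx]
    · rw [indicator_of_notMem hx0]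

lemma IsTSPlus.measureMellin_eq {μ : Measure ℝ} {α β lam : ℝ} (h : IsTSPlus μ α β lam)
    (hα : 0 < α) (hβ : 0 < β) (hβ1 : β < 1) (hlam : 0 < lam) {c : ℝ} (hc : c < 0) (y : ℝ) :
    measureMellin (expTilt μ lam) c y = (Real.exp (tsA α β * lam ^ β) / β : ℂ) *
      ((tsA α β : ℂ) ^ (vline c y / β) *
        (Gamma (-vline c y / β) * (Gamma (-vline c y))⁻¹)) := by
  have := (h.negative_moment hα hβ hβ1 hlam (w := -vline c y) (by simpa [vline] using hc)).2
  simp only [neg_neg] at this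
  rw [measureMellin]
  simp only [vline] at this ⊢
  rw [this, neg_div, neg_neg, div_eq_mul_inv, div_eq_mul_inv, div_eq_mul_inv]
  ring

lemma integrable_cpow_mul {α : Type*} [MeasurableSpace α] {m : Measure α} {A e : ℝ} (hA : 0 < A)
    {s f : α → ℂ} (hs : Measurable s) (hre : ∀ x, (s x).re = e) (hf : Integrable f m) :
    Integrable (fun x => (A : ℂ) ^ (s x) * f x) m := by
  refine (hf.norm.const_mul (A ^ e)).mono'
    ((Measurable.aestronglyMeasurable (by fun_prop)).mul hf.aestronglyMeasurable)
    (Eventually.of_forall fun x => ?_)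
  rw [norm_mul, norm_cpow_eq_rpow_re_of_pos hA, hre]

lemma IsTSPlus.integrable_measureMellin {μ : Measure ℝ} {α β lam : ℝ} (h : IsTSPlus μ α β lam)
    (hα : 0 < α) (hβ : 0 < β) (hβ1 : β < 1) (hlam : 0 < lam) {c : ℝ} (hc : c < 0)
    (hc1 : -1 < c) : Integrable (measureMellin (expTilt μ lam) c) := by
  have h1 := (integrable_cpow_mul (A := tsA α β) (e := c / β) (s := fun y => vline c y / β)
    (tsA_pos hα hβ hβ1) (by unfold vline; fun_prop) (fun y => by rw [div_ofReal_re, vline_re])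
    (integrable_Gamma_div_Gamma hβ hβ1 hc hc1)).const_mul (Real.exp (tsA α β * lam ^ β) / β : ℂ)
  refine h1.congr (Eventually.of_forall fun y => ?_)
  exact (h.measureMellin_eq hα hβ hβ1 hlam hc y).symm

lemma IsTSPlus.coupledFactor_eq {μ : Measure ℝ} {α β lam : ℝ} (h : IsTSPlus μ α β lam)
    (hα : 0 < α) (hβ : 0 < β) (hβ1 : β < 1) (hlam : 0 < lam) {c σ : ℝ} (hc : c < 0)
    (p : ℝ × ℝ) : coupledFactor (measureMellin (expTilt μ lam) c) c σ p =
      (Real.exp (tsA α β * lam ^ β) / β : ℂ) * ((tsA α β : ℂ) ^ (vline c p.1 / β) *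
        (Gamma (-vline c p.1 / β) * (Gamma (-vline c p.1))⁻¹ * (Gamma (1 + vline c p.1))⁻¹ *
          (Gamma (vline σ p.2) * Gamma (1 + vline c p.1 - vline σ p.2)))) := by
  rw [coupledFactor, h.measureMellin_eq hα hβ hβ1 hlam hc]
  ring

lemma IsTSPlus.integrable_coupledFactor {μ : Measure ℝ} {α β lam : ℝ} (h : IsTSPlus μ α β lam)
    (hα : 0 < α) (hβ : 0 < β) (hβ1 : β < 1) (hlam : 0 < lam) {c σ : ℝ} (hc : c < 0)
    (hσ : 0 < σ) (hσc : σ < 1 + c) :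
    Integrable (coupledFactor (measureMellin (expTilt μ lam) c) c σ) := by
  have h1 := (integrable_cpow_mul (A := tsA α β) (e := c / β)
    (s := fun p : ℝ × ℝ => vline c p.1 / β)
    (tsA_pos hα hβ hβ1) (by unfold vline; fun_prop) (fun y => by rw [div_ofReal_re, vline_re])
    (integrable_coupled_gamma hβ hβ1 hc hσ hσc)).const_mul
    (Real.exp (tsA α β * lam ^ β) / β : ℂ)
  refine h1.congr (Eventually.of_forall fun p => ?_)
  exact (h.coupledFactor_eq hα hβ hβ1 hlam hc p).symm

/-- Admissibility in the new coordinates: the real parts of `V`, `W`, `1 + S - W`, `-S`, `R` and `S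
- W + R` are positive. The order `V + W = -s₂` is then positive automatically. -/
lemma re_pos_of_mem_admissible (c : Fin 4 → ℝ) (hβp : 0 < βp)
    (hc : c ∈ admissible βp βm) :
    0 < c 2 - (c 0 + c 1) / 2 ∧ 0 < (c 0 - c 1) / 2 - c 2 ∧ (c 0 - c 1) / 2 - c 2 < 1 + c 0 ∧
      c 0 < 0 ∧ 0 < c 3 ∧ 0 < c 0 - ((c 0 - c 1) / 2 - c 2) + c 3 := by
  obtain ⟨h, hs⟩ := hc
  have h0 := h 0
  have h1 := h 1
  have h2 := h 2
  have h3 := h 3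
  have h5 := h 5
  simp [matU, vecU, dotProduct, Fin.sum_univ_succ] at h0 h1 h2 h3 h5 hs
  have h3' : c 0 < 0 := by
    by_contra hcon
    have := mul_nonneg (inv_nonneg.2 hβp.le) (not_lt.1 hcon)
    linarith
  refine ⟨?_, ?_, ?_, h3', h5, ?_⟩ <;> linarith

/-- The Mellin–Barnes representation of the truncated exponential moments of a tempered stable
law. -/
theorem truncated_moment_eq_mbIntegral (hp : IsTSPlus μp αp βp lamp)
    (hm : IsTSPlus μm αm βm lamm) (hαp : 0 < αp) (hβp : 0 < βp) (hβp1 : βp < 1)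
    (hlamp : 0 < lamp) (hαm : 0 < αm) (hβm : 0 < βm) (hβm1 : βm < 1) (hlamm : 0 < lamm)
    {b : ℝ} (hb : 0 < b) (hbl : b ≤ lamp) {κ : ℝ} (hκ : 0 < κ) {c : Fin 4 → ℝ}
    (hc : c ∈ admissible βp βm) :
    MBIntegrable c
        (callIntegrand βp βm (lamp + lamm) b (tsA αp βp) (tsA αm βm) (-κ)) ∧
      ((∫ x, truncExp κ (lamp - b) x ∂(μp.conv (μm.map fun x => -x)) : ℝ) : ℂ) =
        ((Real.exp (tsA αp βp * lamp ^ βp + tsA αm βm * lamm ^ βm) / (βp * βm) : ℝ) : ℂ) *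
          mbIntegral c
            (callIntegrand βp βm (lamp + lamm) b (tsA αp βp) (tsA αm βm) (-κ)) := by
  have hprp := hp.isProb
  have hprm := hm.isProb
  obtain ⟨hV, hW, hW1, hc0, h4, hθ⟩ := re_pos_of_mem_admissible c hβp hc
  set cW := (c 0 - c 1) / 2 - c 2 with hcW
  set cV := c 2 - (c 0 + c 1) / 2 with hcV
  set Φ := callIntegrand βp βm (lamp + lamm) b (tsA αp βp) (tsA αm βm) (-κ) with hΦ
  set D : ℂ := ((Real.exp (tsA αp βp * lamp ^ βp + tsA αm βm * lamm ^ βm) / (βp * βm) : ℝ) : ℂ)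
    with hD
  have hD0 : D ≠ 0 := ofReal_ne_zero.2 (by positivity)
  have hposp : ∀ᵐ z ∂(expTilt μp lamp), 0 < z :=
    (withDensity_absolutelyContinuous _ _).ae_le (hp.ae_pos hαp hβp hβp1 hlamp)
  have hposm : ∀ᵐ z ∂(expTilt μm lamm), 0 < z :=
    (withDensity_absolutelyContinuous _ _).ae_le (hm.ae_pos hαm hβm hβm1 hlamm)
  have hνm : Integrable (fun z : ℝ => (z : ℂ) ^ (-((cV + cW : ℝ) : ℂ))) (expTilt μm lamm) :=
    (hm.negative_moment hαm hβm hβm1 hlamm (by rw [ofReal_re]; linarith)).1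
  have hνp : Integrable (fun z : ℝ => (z : ℂ) ^ ((c 0 : ℝ) : ℂ)) (expTilt μp lamp) := by
    have := (hp.negative_moment hαp hβp hβp1 hlamp (w := -(c 0 : ℂ)) (by simpa using hc0)).1
    simpa only [neg_neg] using this
  obtain ⟨hGint, hJint, hGeq⟩ := mb_representation (νm := expTilt μm lamm)
    (νp := expTilt μp lamp) (G := fun p => D * Φ (contourPoint c (contourCoord p))) hposm hκ hθ
    hW hW1 hV h4 (add_pos hlamp hlamm) hb hνm
    (hp.integrable_coupledFactor hαp hβp hβp1 hlamp hc0 hW hW1) (by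
      intro p
      rw [contourPoint_contourCoord c p (S := vline (c 0) p.1.1) (W := vline cW p.1.2)
        (V := vline cV p.2.1) (R := vline (c 3) p.2.2) rfl rfl rfl rfl, hΦ, callIntegrand_eq,
        hp.coupledFactor_eq hαp hβp hβp1 hlamp hc0,
        (hm.negative_moment hαm hβm hβm1 hlamm (w := vline cV p.2.1 + vline cW p.1.2)
          (by rw [add_re, vline_re, vline_re]; linarith)).2, hD, Real.exp_add]
      push_cast
      simp only [div_eq_mul_inv, mul_inv]
      ring)
  have hΦint : Integrable fun p => Φ (contourPoint c (contourCoord p)) := by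
    have := hGint.const_mul D⁻¹
    simpa only [← mul_assoc, inv_mul_cancel₀ hD0, one_mul] using this
  have hpi : ((2 * Real.pi) ^ 4 : ℂ) ≠ 0 := by simp [Real.pi_ne_zero]
  refine ⟨?_, ?_⟩
  · exact (measurePreserving_contourCoord.integrable_comp_emb
      contourCoord.measurableEmbedding).1 hΦint
  have hmb : D * mbIntegral c Φ = ∫ q : ℝ × ℝ, mellinDensity (expTilt μp lamp) (c 0) (q.2 + q.1) *
          (Real.exp (-((lamp + lamm) * q.1)) * Real.exp (-(b * q.2)) : ℂ)
          ∂((expTilt μm lamm).prod (volume.restrict (Ioi κ))) := by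
    rw [mbIntegral, integral_mul_const,
      ← measurePreserving_contourCoord.integral_comp' fun y => Φ (contourPoint c y)]
    rw [integral_const_mul] at hGeq
    rw [mul_pow _ I, I_pow_four, mul_one, mul_one, mul_div_assoc', hGeq,
      mul_div_cancel_left₀ _ hpi]
  -- The condition `-1 < c 0` follows from `0 < cW < 1 + c 0`.
  obtain ⟨g, hgm, hg, hgν⟩ := exists_density_of_integrable_mellin hposp hc0 hνp
    (hp.integrable_measureMellin hαp hβp hβp1 hlamp hc0 (by linarith))
  rw [hmb, integral_prod _ hJint, conv_map_neg,
    integral_map (by fun_prop) (measurable_truncExp _ _).aestronglyMeasurable,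
    integral_prod_symm _ (integrable_truncExp_sub hp hm hαp hβp hβp1 hlamp hb hbl κ),
    ← integral_complex_ofReal, integral_expTilt]
  refine integral_congr_ae ?_
  filter_upwards [hm.ae_pos hαm hβm hβm1 hlamm] with z hz
  have e1 : ∫ x in Ioi κ, mellinDensity (expTilt μp lamp) (c 0) (x + z) *
      ((Real.exp (-((lamp + lamm) * z)) : ℂ) * (Real.exp (-(b * x)) : ℂ)) =
      (Real.exp (-((lamp + lamm) * z)) : ℂ) *
        ∫ x in Ioi κ, (g (x + z) : ℂ) * (Real.exp (-(b * x)) : ℂ) := by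
    rw [← integral_const_mul]
    refine setIntegral_congr_fun measurableSet_Ioi fun x hx => ?_
    rw [(hg (x + z) (add_pos (hκ.trans hx) hz)).2]
    ring
  rw [e1, integral_density_shift hgm (fun y hy => (hg y hy).1) hgν hκ hz, integral_complex_ofReal,
    ← mul_assoc, ← mul_assoc, ← ofReal_mul, ← ofReal_mul, ← Real.exp_add, ← Real.exp_add]
  -- The two tilts cancel `e^{-(λ₊+λ₋) z}` exactly.
  rw [show lamm * z + -((lamp + lamm) * z) + lamp * z = 0 by ring, Real.exp_zero, ofReal_one,
    one_mul]

end TruncatedMoments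

/-! ### From truncated moments to option prices. -/

section Pricing

open Set Filter

variable {Ω : Type*} [MeasurableSpace Ω] {P : Measure Ω}
  {X : ℝ≥0 → Ω → ℝ} {αp βp lamp αm βm lamm : ℝ}

/-- The initial σ-algebra of a process started from `0` is trivial. -/
lemma condExp_natural_zero [IsProbabilityMeasure P]
    (hXm : ∀ t, StronglyMeasurable (X t)) (h0 : ∀ᵐ ω ∂P, X 0 ω = 0)
    (T : ℝ≥0) {φ : ℝ → ℝ} (hφ : Measurable φ) :
    P[fun ω => φ (X T ω) | Filtration.natural X hXm 0] =ᵐ[P] fun _ => ∫ ω, φ (X T ω) ∂P := by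
  -- `X 0` is almost surely constant, hence independent of everything.
  have hind : IndepFun (X T) (X 0) P := by
    refine (indepFun_const_right (X T) (0 : ℝ)).congr (EventuallyEq.refl _ _) ?_
    filter_upwards [h0] with ω hω using hω.symm
  have hnat : (Filtration.natural X hXm 0 : MeasurableSpace Ω) =
      MeasurableSpace.comap (X 0) inferInstance := by
    refine le_antisymm (iSup₂_le fun j hj => ?_) (le_iSup₂_of_le 0 le_rfl le_rfl)
    rw [nonpos_iff_eq_zero.1 hj]
  refine condExp_indep_eq (m₁ := MeasurableSpace.comap (X T) inferInstance)
    (hXm T).measurable.comap_le (Filtration.le _ _) ?_ ?_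
  · exact (hφ.comp (comap_measurable (X T))).stronglyMeasurable
  · rw [hnat]
    exact (IndepFun_iff_Indep _ _ _).1 hind

lemma IsTSProcess.exists_law (hX : IsTSProcess P X αp βp lamp αm βm lamm) {T : ℝ≥0} (hT : 0 < T) :
    ∃ μp μm : Measure ℝ, IsTSPlus μp (αp * T) βp lamp ∧ IsTSPlus μm (αm * T) βm lamm ∧
      P.map (X T) = μp.conv (μm.map fun x => -x) := by
  obtain ⟨μp, μm, hp, hm, h⟩ := hX.law 0 T hT
  simp only [NNReal.coe_zero, sub_zero] at hp hm
  refine ⟨μp, μm, hp, hm, ?_⟩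
  rw [← h]
  refine Measure.map_congr ?_
  filter_upwards [hX.zero] with ω hω
  rw [hω, sub_zero]

lemma tsA_mul (α β T : ℝ) : tsA (α * T) β = tsA α β * T := by
  unfold tsA; ring

lemma exp_moneyness {S₀ K r q ζ T : ℝ} (hS₀ : 0 < S₀) (hK : 0 < K) (x : ℝ) :
    S₀ * Real.exp ((r - q + ζ) * T + x) = K * Real.exp (moneyness S₀ K r q ζ T + x) := by
  rw [moneyness, add_assoc, Real.exp_add (Real.log _), Real.exp_log (div_pos hS₀ hK)]
  field_simp

lemma lt_exp_moneyness_iff {S₀ K r q ζ T : ℝ} (hS₀ : 0 < S₀) (hK : 0 < K) (x : ℝ) :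
    K < S₀ * Real.exp ((r - q + ζ) * T + x) ↔ -moneyness S₀ K r q ζ T < x := by
  rw [exp_moneyness hS₀ hK, lt_mul_iff_one_lt_right hK, Real.one_lt_exp_iff]
  constructor <;> intro h <;> linarith

/-- The zero exponent is written `lam - lam` to fit the common form `lamp - b` with `b = lamp`. -/
lemma payoffCN_eq {S₀ K r q ζ T : ℝ} (hS₀ : 0 < S₀) (hK : 0 < K) (lam x : ℝ) :
    payoffCN K (S₀ * Real.exp ((r - q + ζ) * T + x)) =
      truncExp (-moneyness S₀ K r q ζ T) (lam - lam) x := by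
  have h := lt_exp_moneyness_iff (r := r) (q := q) (ζ := ζ) (T := T) hS₀ hK x
  by_cases hx : -moneyness S₀ K r q ζ T < x
  · rw [payoffCN, truncExp, indicator_of_mem (mem_Ioi.2 (h.2 hx)), indicator_of_mem (mem_Ioi.2 hx)]
    simp
  · rw [payoffCN, truncExp, indicator_of_notMem (mt (fun hS => h.1 (mem_Ioi.1 hS)) hx),
      indicator_of_notMem (mt mem_Ioi.1 hx)]

lemma payoffAN_eq {S₀ K r q ζ T : ℝ} (hS₀ : 0 < S₀) (hK : 0 < K) (lam x : ℝ) :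
    payoffAN K (S₀ * Real.exp ((r - q + ζ) * T + x)) =
      K * Real.exp (moneyness S₀ K r q ζ T) *
        truncExp (-moneyness S₀ K r q ζ T) (lam - (lam - 1)) x := by
  have h := lt_exp_moneyness_iff (r := r) (q := q) (ζ := ζ) (T := T) hS₀ hK x
  by_cases hx : -moneyness S₀ K r q ζ T < x
  · rw [payoffAN, truncExp, indicator_of_mem (mem_Ioi.2 (h.2 hx)), indicator_of_mem (mem_Ioi.2 hx),
      exp_moneyness hS₀ hK, Real.exp_add, sub_sub_cancel, one_mul]
    ring
  · rw [payoffAN, truncExp, indicator_of_notMem (mt (fun hS => h.1 (mem_Ioi.1 hS)) hx),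
      indicator_of_notMem (mt mem_Ioi.1 hx), mul_zero]

/-- The price of a claim paying a multiple of a truncated exponential of `X_T`. -/
theorem claimPrice_eq_mbIntegral [IsProbabilityMeasure P]
    (hαp : 0 < αp) (hβp : 0 < βp) (hβp1 : βp < 1) (hlamp : 0 < lamp)
    (hαm : 0 < αm) (hβm : 0 < βm) (hβm1 : βm < 1) (hlamm : 0 < lamm)
    (hXm : ∀ t, StronglyMeasurable (X t))
    (hX : IsTSProcess P X αp βp lamp αm βm lamm)
    {S₀ r q ζ : ℝ} {T : ℝ≥0} (hT : 0 < T) {b κ B : ℝ} (hb : 0 < b) (hbl : b ≤ lamp)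
    (hκ : 0 < κ) {payoff : ℝ → ℝ}
    (hpay : ∀ x, payoff (S₀ * Real.exp ((r - q + ζ) * T + x)) = B * truncExp κ (lamp - b) x)
    {c : Fin 4 → ℝ} (hc : c ∈ admissible βp βm) :
    Integrable (fun ω => payoff (assetPrice X S₀ r q ζ T ω)) P ∧
      MBIntegrable c
        (callIntegrand βp βm (lamp + lamm) b (tsA αp βp * T) (tsA αm βm * T) (-κ)) ∧
      ∀ᵐ ω ∂P, ((claimPrice P X hXm S₀ r q ζ payoff T 0 ω : ℝ) : ℂ) =
        ((B * Real.exp ((tsGamma αp βp lamp αm βm lamm - r) * T) / (βp * βm) : ℝ) : ℂ) *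
          mbIntegral c
            (callIntegrand βp βm (lamp + lamm) b (tsA αp βp * T) (tsA αm βm * T) (-κ)) := by
  obtain ⟨μp, μm, hp, hm, hlaw⟩ := hX.exists_law hT
  have hprp := hp.isProb
  have hprm := hm.isProb
  have hT' : (0 : ℝ) < T := hT
  obtain ⟨hMB, hval⟩ := truncated_moment_eq_mbIntegral hp hm (mul_pos hαp hT') hβp hβp1 hlamp
    (mul_pos hαm hT') hβm hβm1 hlamm hb hbl hκ hc
  rw [tsA_mul, tsA_mul] at hMB hval
  have hXT : Measurable (X T) := (hXm T).measurable
  have htm := measurable_truncExp κ (lamp - b)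
  have hpayX : ∀ ω, payoff (assetPrice X S₀ r q ζ T ω) = B * truncExp κ (lamp - b) (X T ω) :=
    fun ω => hpay (X T ω)
  have hinteg : Integrable (fun ω => truncExp κ (lamp - b) (X T ω)) P := by
    have h1 : Integrable (truncExp κ (lamp - b)) (P.map (X T)) := by
      rw [hlaw, conv_map_neg, integrable_map_measure htm.aestronglyMeasurable (by fun_prop)]
      exact integrable_truncExp_sub hp hm (mul_pos hαp hT') hβp hβp1 hlamp hb hbl κ
    exact (integrable_map_measure htm.aestronglyMeasurable hXT.aemeasurable).1 h1
  have hE : ∫ ω, truncExp κ (lamp - b) (X T ω) ∂P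
      = ∫ x, truncExp κ (lamp - b) x ∂(μp.conv (μm.map fun x => -x)) := by
    rw [← hlaw, integral_map hXT.aemeasurable htm.aestronglyMeasurable]
  refine ⟨?_, hMB, ?_⟩
  · simp_rw [hpayX]
    exact hinteg.const_mul B
  · have hcond := condExp_natural_zero hXm hX.zero T
      (φ := fun x => Real.exp (-r * T) * (B * truncExp κ (lamp - b) x)) (by fun_prop)
    filter_upwards [hcond] with ω hω
    rw [claimPrice]
    simp_rw [hpayX, NNReal.coe_zero, sub_zero]
    rw [hω, integral_const_mul, integral_const_mul, hE]
    push_cast at hval ⊢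
    rw [hval]
    have hexp : Complex.exp ((tsGamma αp βp lamp αm βm lamm - r) * T) = Complex.exp (-r * T) *
        Complex.exp (tsA αp βp * T * (lamp ^ βp : ℝ) + tsA αm βm * T * (lamm ^ βm : ℝ)) := by
      rw [← Complex.exp_add]
      congr 1
      rw [tsGamma]
      push_cast
      ring
    rw [hexp]
    ring

end Pricing

theorem mainTheorem10 {Ω : Type*} [MeasurableSpace Ω] (P : Measure Ω) [IsProbabilityMeasure P]
    (αp βp lamp αm βm lamm : ℝ)
    (hαp : 0 < αp) (hβp : 0 < βp) (hβp1 : βp < 1) (hlamp : 1 < lamp)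
    (hαm : 0 < αm) (hβm : 0 < βm) (hβm1 : βm < 1) (hlamm : 0 < lamm)
    (X : ℝ≥0 → Ω → ℝ) (hXm : ∀ t, StronglyMeasurable (X t))
    (hX : IsTSProcess P X αp βp lamp αm βm lamm)
    (S₀ K r q : ℝ) (hS₀ : 0 < S₀) (hK : 0 < K) (T : ℝ≥0) (hT : 0 < T)
    (ζ γ k : ℝ)
    (hζ : ζ = tsZeta αp βp lamp αm βm lamm)
    (hγ : γ = tsGamma αp βp lamp αm βm lamm)
    (hk : k = moneyness S₀ K r q ζ T) (hk0 : k < 0)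
    (c : Fin 4 → ℝ) (hc : c ∈ admissible βp βm) :
    (Integrable (fun ω => payoffCN K (assetPrice X S₀ r q ζ T ω)) P ∧
      MBIntegrable c
        (callIntegrand βp βm (lamp + lamm) lamp (tsA αp βp * T) (tsA αm βm * T) k) ∧
      ∀ᵐ ω ∂P, ((claimPrice P X hXm S₀ r q ζ (payoffCN K) T 0 ω : ℝ) : ℂ) =
        ((Real.exp ((γ - r) * T) / (βp * βm) : ℝ) : ℂ) *
          mbIntegral c
            (callIntegrand βp βm (lamp + lamm) lamp (tsA αp βp * T) (tsA αm βm * T) k)) ∧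
    (Integrable (fun ω => payoffAN K (assetPrice X S₀ r q ζ T ω)) P ∧
      MBIntegrable c
        (callIntegrand βp βm (lamp + lamm) (lamp - 1) (tsA αp βp * T) (tsA αm βm * T) k) ∧
      ∀ᵐ ω ∂P, ((claimPrice P X hXm S₀ r q ζ (payoffAN K) T 0 ω : ℝ) : ℂ) =
        ((K * Real.exp (k + (γ - r) * T) / (βp * βm) : ℝ) : ℂ) *
          mbIntegral c
            (callIntegrand βp βm (lamp + lamm) (lamp - 1)
              (tsA αp βp * T) (tsA αm βm * T) k)) := by
  subst hγ
  have hlamp0 : 0 < lamp := by linarith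
  have hκ : 0 < -k := by linarith
  refine ⟨?_, ?_⟩
  · have h := claimPrice_eq_mbIntegral hαp hβp hβp1 hlamp0 hαm hβm hβm1 hlamm hXm hX
      (S₀ := S₀) (r := r) (q := q) (ζ := ζ) hT (b := lamp) (B := 1) hlamp0 le_rfl hκ
      (payoff := payoffCN K) (fun x => by rw [one_mul, hk]; exact payoffCN_eq hS₀ hK lamp x) hc
    rwa [neg_neg, one_mul] at h
  -- The factor `S_T = K e^{k + X_T}` raises the exponent to `1`, so `b = lamp - 1`, which is
  -- positive because `1 < lamp`.
  · have h := claimPrice_eq_mbIntegral hαp hβp hβp1 hlamp0 hαm hβm hβm1 hlamm hXm hX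
      (S₀ := S₀) (r := r) (q := q) (ζ := ζ) hT (b := lamp - 1) (B := K * Real.exp k)
      (by linarith) (by linarith) hκ
      (payoff := payoffAN K) (fun x => by rw [hk]; exact payoffAN_eq hS₀ hK lamp x) hc
    rwa [neg_neg, mul_assoc K, ← Real.exp_add] at h
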